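/- Let $n\ge 4$ and $p>1$ satisfy $F(p,p,n)=0$, where $$F(p,q,n)=\max\left\{\frac{q+2+p^{-1}}{pq-1},\ \frac{p+2+q^{-1}}{pq-1}\right\}-\frac{n-1}{2}.$$ Then there is a convergent real sequence $(S'_j)$, depending only on $n$ and $p$, such that the following holds. Let $R>0$ and let $f_1,g_1,f_2,g_2$ be non-negative functions on $\mathbb R^n$ that vanish for $|x|>R$, with $f_1\in H^1(\mathbb R^n)\cap L^p(\mathbb R^n)$, $f_2\in H^1(\mathbb R^n)$, $g_1,g_2\in L^2(\mathbb R^n)$, where neither $g_1$ nor $g_2$ vanishes identically. There is a constant $\tilde C>0$, depending only on $n,p,R,f_2,g_2$ (in particular not on $\varepsilon$, $t$, $j$ or the solution), with the following property. Let $\varepsilon>0$, $0<T\le\infty$, and let $(u,v)$ be a weak solution on $\mathbb R^n\times[0,T)$ of $$u_{tt}-\Delta u=|v|^p,\qquad v_{tt}-\Delta v=|u|^p,$$ $$u(\cdot,0)=\varepsilon f_1,\quad u_t(\cdot,0)=\varepsilon g_1,\quad v(\cdot,0)=\varepsilon f_2,\quad v_t(\cdot,0)=\varepsilon g_2,$$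 with $u\in C([0,T);H^1(\mathbb R^n)\cap L^p(\mathbb R^n))$, $v\in C([0,T);H^1(\mathbb R^n))$, $u_t,v_t\in C([0,T);L^2(\mathbb R^n))$, such that $u,v,u_t,v_t$ are supported in $\{(x,t): |x|\le t+R\}$. Then $U(t)=\int_{\mathbb R^n}u(x,t)\,dx$ is of class $C^2$ on $[0,T)$ and, for every integer $j\ge1$ and every $t\in[0,T)$ with $t\ge b_jR$, where $b_j=10\cdot4^{j-1}-2$, $$U''(t)\ \ge\ D_j\,(t-b_jR)^{\,n-1-(n-1)p/2}\left(\log\frac{t+(b_j^2-6)R}{(b_j-2)(b_j+3)R}\right)^{\frac{p^{2j}-1}{p-1}},$$ where $$D_1=\tilde C\,\varepsilon^{p^3},\qquad D_j=\exp\{p^{2(j-1)}(\log D_1+S'_j)\}\quad(j\ge2).$$ Here $0^0=1$. A weak solution means that the initial conditions hold and, for every $\varphi\in C_c^\infty(\mathbb R^n)$ and every $t\in[0,T)$, $$\frac{d}{dt}\int u_t\varphi\,dx+\int\nabla u\cdot\nabla\varphi\,dx=\int|v|^p\varphi\,dx,\qquad \frac{d}{dt}\int v_t\varphi\,dx+\int\nabla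 v\cdot\nabla\varphi\,dx=\int|u|^p\varphi\,dx.$$ -/

import Mathlib

open MeasureTheory Filter Topology
open scoped ContDiff ENNReal

noncomputable section

namespace WaveSystem

/-- The space `ℝⁿ` with its Euclidean norm. -/
abbrev Space (n : ℕ) : Type := EuclideanSpace ℝ (Fin n)

/-- Real-valued `L²(ℝⁿ)`. -/
abbrev L2 (n : ℕ) : Type := Lp ℝ 2 (volume : Measure (Space n))

/-- Vector-valued `L²(ℝⁿ; ℝⁿ)`, where gradients live. -/
abbrev L2Vec (n : ℕ) : Type := Lp (Space n) 2 (volume : Measure (Space n))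

/-- Test functions `φ ∈ C_c^∞(ℝⁿ)`. -/
def IsTestFunction {n : ℕ} (φ : Space n → ℝ) : Prop :=
  ContDiff ℝ ∞ φ ∧ HasCompactSupport φ

/-- `w` is the weak gradient of `f`: `∫ f ∇φ = - ∫ φ w` for all test functions `φ`. -/
def IsWeakGradient {n : ℕ} (f : L2 n) (w : L2Vec n) : Prop :=
  ∀ φ : Space n → ℝ, IsTestFunction φ →
    ∫ x, f x • gradient φ x = - ∫ x, φ x • w x

/-- `f ∈ H¹(ℝⁿ)`. -/
def MemH1 {n : ℕ} (f : L2 n) : Prop := ∃ w : L2Vec n, IsWeakGradient f w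

/-- `f(x) = 0` for (almost every) `|x| > r`. -/
def VanishesOutside {n : ℕ} (r : ℝ) (f : L2 n) : Prop :=
  ∀ᵐ x : Space n, r < ‖x‖ → f x = 0

/-- Admissible initial position (up to the factor `ε`): `f ∈ H¹`, `f ≥ 0`, `f = 0` for `|x| > R`. -/
structure IsInitialPosition {n : ℕ} (R : ℝ) (f : L2 n) : Prop where
  memH1 : MemH1 f
  nonneg : 0 ≤ f
  support : VanishesOutside R f

/-- Admissible initial velocity (up to the factor `ε`): `g ∈ L²`, `g ≥ 0`, `g` does not vanish
identically, `g = 0` for `|x| > R`. -/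
structure IsInitialVelocity {n : ℕ} (R : ℝ) (g : L2 n) : Prop where
  nonneg : 0 ≤ g
  ne_zero : g ≠ 0
  support : VanishesOutside R g

/-- The time interval `[0, T)`, where `T = ∞` is allowed. -/
def timeInterval (T : EReal) : Set ℝ := {t : ℝ | 0 ≤ t ∧ (t : EReal) < T}

/-- `f ∈ C(I; L^r(ℝⁿ))` for a family `f` of `L²` functions. -/
def ContinuousInLp {n : ℕ} (r : ℝ) (I : Set ℝ) (f : ℝ → L2 n) : Prop :=
  (∀ t ∈ I, MemLp (f t) (ENNReal.ofReal r) volume) ∧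
  ∀ t₀ ∈ I, Tendsto
    (fun t => eLpNorm (fun x => f t x - f t₀ x) (ENNReal.ofReal r) volume) (𝓝[I] t₀) (𝓝 0)

/-- One component of the system. It says that `w ∈ C([0,T); H¹)`, that `w` has the time derivative
`wt ∈ C([0,T); L²)`, that `w(0) = w₀` and `wt(0) = w₁`, that `w` and `wt` vanish for
`|x| > t + R`, and that `w_tt - Δw = |z|^r` holds weakly on `[0,T)`, i.e. for every test function
`φ` on `ℝⁿ`, `d/dt ∫ wt φ + ∫ ∇w · ∇φ = ∫ |z|^r φ`. -/
structure IsWeakWave {n : ℕ} (r R : ℝ) (T : EReal) (w₀ w₁ : L2 n) (z w wt : ℝ → L2 n) : Prop where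
  /-- `w ∈ C([0,T); H¹)` and the weak form of the equation, `Dw` being the spatial gradient. -/
  equation : ∃ Dw : ℝ → L2Vec n,
    (∀ t ∈ timeInterval T, IsWeakGradient (w t) (Dw t)) ∧
    ContinuousOn w (timeInterval T) ∧
    ContinuousOn Dw (timeInterval T) ∧
    ∀ φ : Space n → ℝ, IsTestFunction φ → ∀ t ∈ timeInterval T,
      HasDerivWithinAt (fun s => ∫ x, wt s x * φ x)
        (- (∫ x, inner ℝ (Dw t x) (gradient φ x)) + ∫ x, |z t x| ^ r * φ x)
        (timeInterval T) t
  time_deriv : ∀ t ∈ timeInterval T, HasDerivWithinAt w (wt t) (timeInterval T) t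
  time_deriv_continuous : ContinuousOn wt (timeInterval T)
  init_pos : w 0 = w₀
  init_vel : wt 0 = w₁
  support : ∀ t ∈ timeInterval T, VanishesOutside (t + R) (w t)
  support_vel : ∀ t ∈ timeInterval T, VanishesOutside (t + R) (wt t)

/-- `(u, v)`, with time derivatives `(ut, vt)`, is a solution on `[0,T)` of
`u_tt - Δu = |v|^p`, `v_tt - Δv = |u|^q` with data `u(0) = ε f₁`, `u_t(0) = ε g₁`,
`v(0) = ε f₂`, `v_t(0) = ε g₂`, in the class `u ∈ C([0,T); H¹ ∩ L^q)`, `v ∈ C([0,T); H¹)`,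
`u_t, v_t ∈ C([0,T); L²)`, supported in `|x| ≤ t + R`. -/
structure IsSolution {n : ℕ} (p q R ε : ℝ) (T : EReal) (f₁ g₁ f₂ g₂ : L2 n)
    (u ut v vt : ℝ → L2 n) : Prop where
  first : IsWeakWave p R T (ε • f₁) (ε • g₁) v u ut
  second : IsWeakWave q R T (ε • f₂) (ε • g₂) u v vt
  continuous_Lq : ContinuousInLp q (timeInterval T) u

/-- `F(p,q,n)`, whose vanishing defines the critical case. -/
def criticalF (p q : ℝ) (n : ℕ) : ℝ :=
  max ((q + 2 + p⁻¹) / (p * q - 1)) ((p + 2 + q⁻¹) / (p * q - 1)) - ((n : ℝ) - 1) / 2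

/-- The spatial mean `t ↦ ∫ u(x,t) dx`. -/
def spatialIntegral {n : ℕ} (u : ℝ → L2 n) (t : ℝ) : ℝ := ∫ x, u t x

/-- `b_j = 10 · 4^(j-1) - 2`, for `j ≥ 1`. -/
def b (j : ℕ) : ℝ := 10 * 4 ^ (j - 1) - 2

/-- `D_1 = C ε^(p³)` and `D_j = exp(p^(2(j-1)) (log D_1 + S_j))` for `j ≥ 2`. -/
def D (p C ε : ℝ) (S : ℕ → ℝ) (j : ℕ) : ℝ :=
  if j = 1 then C * ε ^ (p ^ 3)
  else Real.exp (p ^ (2 * (j - 1)) * (Real.log (C * ε ^ (p ^ 3)) + S j))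

end WaveSystem

end

/-!
The second derivative of `∫ u` is the source term `∫ |v|^p` (test the equation with a cutoff that
is `1` on the support), so lower bounds for `∫ |u|^p` and `∫ |v|^p` are needed. They come from
averaging the equation against eigenfunctions of the Laplacian. For `ξ ≠ 0` the pairing of a
component `w` with `cosh ⟨ξ, x⟩` satisfies `E'' = ‖ξ‖² E + ∫ |z|^p cosh ⟨ξ, x⟩`, and `cosh ≥ 1`,
so Duhamel's formula bounds `E(t)` below by the initial velocity and by
`∫₀ᵗ sinh (‖ξ‖ (t - s)) / ‖ξ‖ · ∫ |z(s)|^p dx ds` (`IsWeakWave.coshPairing_ge`).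

These inequalities are superposed over `ξ` with the density
`∫₀^∞ θ^(γ - 1 - n/2) exp (-θ a² - ‖ξ‖² / (4 θ)) dθ`, where `a = t + 2 R`. Being a mixture of
Gaussians, it turns `cosh ⟨ξ, x⟩` into a constant times `(a² - ‖x‖²)^(-γ)` exactly
(`lintegral_cosh_mixMeasure`). It behaves like a power of `‖ξ‖` times `exp (-a ‖ξ‖)`, so the
frequencies `‖ξ‖ ∼ 1 / (s + 2 R)` give the lower bound
`(s + 2 R)^(-(n - 3)/2 - γ) a^((n - 1)/2 - γ)` for the superposed Duhamel kernel
(`exists_lintegral_sinh_mixMeasure_ge`). Hölder's inequality then yields a lower bound for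
`∫ |w(t)|^p`.

* With `γ = 2 (1 - 1/p)` the initial velocity gives `∫ |v(t)|^p ≥ C ε^p (t + 2 R)^α`, where
  `α = n - 1 - (n - 1) p / 2` (`exists_initial_bound`).
* With `γ = 1 - 1/p` the dual power of the weight is `(a² - ‖x‖²)^(-1)`, whose integral over the
  support is logarithmic, and the criticality `F(p, p, n) = 0` says that the kernel
  `(s + 2 R)^(-α - 1)` turns a source of size `s^α log^k` into `∫ log^k ds / s ∼ log^(k + 1)`.
  After Hölder the exponent of the logarithm is `(k + 1) p - (p - 1) = k p + 1`
  (`exists_source_bound`, `exists_iteration_step`).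

Two such steps, from `v` to `u` and back, turn `b` into `4 b + 6`, `k` into `k p² + p + 1` and the
constant `A` into `A^(p²)` times a factor that is at worst exponentially small in the number of
rounds; hence the logarithms of these factors, divided by `p^(2 j)`, are summable, and `S` is the
sequence of their partial sums. For `n ≥ 4` the critical exponent satisfies `p ≤ 2`, so that
continuity in `L²` suffices for the source terms to be continuous, and `α ≥ 0`.
-/

open MeasureTheory Filter Topology
open scoped ContDiff ENNReal

namespace WaveSystem

variable {n : ℕ}

/-! ### Testing the equation with eigenfunctions of the Laplacian -/

theorem VanishesOutside.integral_mul_congr {r : ℝ} {f : L2 n} (hf : VanishesOutside r f)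
    {φ ψ : Space n → ℝ} (h : ∀ x, ‖x‖ ≤ r → φ x = ψ x) :
    ∫ x, f x * φ x = ∫ x, f x * ψ x := by
  refine integral_congr_ae ?_
  filter_upwards [hf] with x hx
  by_cases hxr : ‖x‖ ≤ r
  · rw [h x hxr]
  · simp [hx (not_le.1 hxr)]

theorem locallyIntegrable_coe (f : L2 n) : LocallyIntegrable (f : Space n → ℝ) volume :=
  (Lp.memLp f).locallyIntegrable (by norm_num)

theorem locallyIntegrable_coe_vec (f : L2Vec n) :
    LocallyIntegrable (f : Space n → Space n) volume :=
  (Lp.memLp f).locallyIntegrable (by norm_num)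

/-- The `i`-th partial derivative. -/
noncomputable def partialDeriv (i : Fin n) (φ : Space n → ℝ) (x : Space n) : ℝ :=
  fderiv ℝ φ x (EuclideanSpace.single i 1)

theorem gradient_apply (φ : Space n → ℝ) (x : Space n) (i : Fin n) :
    gradient φ x i = partialDeriv i φ x := by
  have h1 : inner ℝ (gradient φ x) (EuclideanSpace.single i (1 : ℝ)) = partialDeriv i φ x := by
    simp [gradient, partialDeriv]
  rw [← h1, EuclideanSpace.inner_single_right]
  simp

theorem IsTestFunction.partialDeriv {φ : Space n → ℝ} (hφ : IsTestFunction φ) (i : Fin n) :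
    IsTestFunction (partialDeriv i φ) := by
  refine ⟨?_, ?_⟩
  · exact (hφ.1.fderiv_right (m := ∞) (by simp)).clm_apply contDiff_const
  · exact hφ.2.fderiv_apply (𝕜 := ℝ) _

theorem IsTestFunction.continuous {φ : Space n → ℝ} (hφ : IsTestFunction φ) : Continuous φ :=
  hφ.1.continuous

theorem IsTestFunction.integrable_mul {φ : Space n → ℝ} (hφ : IsTestFunction φ) (f : L2 n) :
    Integrable (fun x => f x * φ x) :=
  (locallyIntegrable_coe f).integrable_smul_right_of_hasCompactSupport hφ.continuous hφ.2

/-- The weak gradient tested against a classical gradient: two integrations by parts. -/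
theorem IsWeakGradient.integral_inner_gradient {f : L2 n} {w : L2Vec n} (h : IsWeakGradient f w)
    {φ : Space n → ℝ} (hφ : IsTestFunction φ) :
    -∫ x, inner ℝ (w x) (gradient φ x)
      = ∫ x, f x * ∑ i, partialDeriv i (partialDeriv i φ) x := by
  have key (i : Fin n) : ∫ x, f x * partialDeriv i (partialDeriv i φ) x
      = -∫ x, w x i * partialDeriv i φ x := by
    have hi := hφ.partialDeriv i
    have h1 := congrArg (EuclideanSpace.proj (𝕜 := ℝ) i) (h _ hi)
    have hgc : Continuous (gradient (partialDeriv i φ)) := by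
      exact (InnerProductSpace.toDual ℝ (Space n)).symm.continuous.comp
        (hi.1.continuous_fderiv (by simp))
    have hgs : HasCompactSupport (gradient (partialDeriv i φ)) := by
      exact (hi.2.fderiv (𝕜 := ℝ)).comp_left (map_zero _)
    rw [← ContinuousLinearMap.integral_comp_comm, map_neg,
      ← ContinuousLinearMap.integral_comp_comm] at h1
    · simp only [PiLp.proj_apply, PiLp.smul_apply, gradient_apply, smul_eq_mul] at h1
      rw [h1]
      congr 1
      exact integral_congr_ae (.of_forall fun x => mul_comm _ _)
    · exact (locallyIntegrable_coe_vec w).integrable_smul_left_of_hasCompactSupport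
        hi.continuous hi.2
    · exact (locallyIntegrable_coe f).integrable_smul_right_of_hasCompactSupport hgc hgs
  have hint (i : Fin n) : Integrable (fun x => w x i * partialDeriv i φ x) := by
    have := ((locallyIntegrable_coe_vec w).integrable_smul_left_of_hasCompactSupport
        (hφ.partialDeriv i).continuous (hφ.partialDeriv i).2)
    have := (EuclideanSpace.proj (𝕜 := ℝ) i).integrable_comp this
    refine this.congr (.of_forall fun x => ?_)
    simp [mul_comm]
  have hsum (x : Space n) : inner ℝ (w x) (gradient φ x) = ∑ i, w x i * partialDeriv i φ x := by
    rw [PiLp.inner_apply]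
    refine Finset.sum_congr rfl fun i _ => ?_
    rw [gradient_apply]; simp [mul_comm]
  simp_rw [hsum, Finset.mul_sum]
  rw [integral_finsetSum _ fun i _ => hint i, integral_finsetSum, ← Finset.sum_neg_distrib]
  · exact (Finset.sum_congr rfl fun i _ => (key i)).symm
  · intro i _
    exact ((hφ.partialDeriv i).partialDeriv i).integrable_mul f

/-- Pairing of an `L²` function of bounded support with the entire function `x ↦ cosh ⟨ξ, x⟩`. -/
noncomputable def coshPairing (ξ : Space n) (f : L2 n) : ℝ := ∫ x, f x * Real.cosh (inner ℝ ξ x)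

theorem exists_testFunction_eq_cosh (ξ : Space n) (r : ℝ) :
    ∃ φ : Space n → ℝ, IsTestFunction φ ∧
      ∀ x ∈ Metric.ball (0 : Space n) r, φ =ᶠ[𝓝 x] fun y => Real.cosh (inner ℝ ξ y) := by
  let χ : ContDiffBump (0 : Space n) := ⟨max r 1, max r 1 + 1, by positivity, by linarith⟩
  refine ⟨fun x => χ x * Real.cosh (inner ℝ ξ x), ⟨?_, ?_⟩, ?_⟩
  · exact χ.contDiff.mul (Real.contDiff_cosh.comp (contDiff_const.inner ℝ contDiff_id))
  · exact χ.hasCompactSupport.mul_right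
  · intro x hx
    have : x ∈ Metric.ball (0 : Space n) χ.rIn :=
      Metric.ball_subset_ball (le_max_left _ _) hx
    filter_upwards [χ.eventuallyEq_one_of_mem_ball this] with y hy
    simp [hy]

theorem partialDeriv_congr {φ ψ : Space n → ℝ} {x : Space n} (h : φ =ᶠ[𝓝 x] ψ) (i : Fin n) :
    partialDeriv i φ =ᶠ[𝓝 x] partialDeriv i ψ := by
  filter_upwards [h.fderiv (𝕜 := ℝ)] with y hy
  simp [partialDeriv, hy]

theorem sum_partialDeriv_cosh (ξ x : Space n) :
    ∑ i, partialDeriv i (partialDeriv i fun y => Real.cosh (inner ℝ ξ y)) x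
      = ‖ξ‖ ^ 2 * Real.cosh (inner ℝ ξ x) := by
  have hin (y : Space n) : HasFDerivAt (fun y => inner ℝ ξ y) (innerSL ℝ ξ) y :=
    (innerSL ℝ ξ).hasFDerivAt
  have h1 (i : Fin n) : (partialDeriv i fun y => Real.cosh (inner ℝ ξ y))
      = fun y => Real.sinh (inner ℝ ξ y) * ξ i := by
    funext y
    rw [partialDeriv, (hin y).cosh.fderiv]
    simp [EuclideanSpace.inner_single_right]
  have h2 (i : Fin n) : partialDeriv i (partialDeriv i fun y => Real.cosh (inner ℝ ξ y)) x
      = ξ i ^ 2 * Real.cosh (inner ℝ ξ x) := by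
    rw [h1, partialDeriv,
      ((hin x).sinh.mul_const (ξ i)).fderiv]
    simp [EuclideanSpace.inner_single_right]
    ring
  simp_rw [h2]
  rw [← Finset.sum_mul, EuclideanSpace.norm_sq_eq]
  simp

/-! ### Source terms -/

/-- The source term `∫ |f|^p` of the wave equation. -/
noncomputable def powIntegral (p : ℝ) (f : L2 n) : ℝ := ∫ x, |f x| ^ p

theorem powIntegral_nonneg (p : ℝ) (f : L2 n) : 0 ≤ powIntegral p f :=
  integral_nonneg fun _ => by positivity

theorem VanishesOutside.integral_rpow_mul_congr {r p : ℝ} (hp : p ≠ 0) {f : L2 n}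
    (hf : VanishesOutside r f) {φ ψ : Space n → ℝ} (h : ∀ x, ‖x‖ ≤ r → φ x = ψ x) :
    ∫ x, |f x| ^ p * φ x = ∫ x, |f x| ^ p * ψ x := by
  refine integral_congr_ae ?_
  filter_upwards [hf] with x hx
  by_cases hxr : ‖x‖ ≤ r
  · rw [h x hxr]
  · simp [hx (not_le.1 hxr), Real.zero_rpow hp]

theorem IsTestFunction.memLp {φ : Space n → ℝ} (hφ : IsTestFunction φ) :
    MemLp φ 2 (volume : Measure (Space n)) :=
  hφ.continuous.memLp_of_hasCompactSupport hφ.2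

variable {r R : ℝ} {T : EReal} {w₀ w₁ : L2 n} {z w wt : ℝ → L2 n}

theorem eventually_add_lt_add_one (t R : ℝ) (I : Set ℝ) : ∀ᶠ s in 𝓝[I] t, s + R < t + R + 1 := by
  refine nhdsWithin_le_nhds ?_
  filter_upwards [eventually_lt_nhds (show t < t + 1 by linarith)] with s hs
  linarith

/-- The pairing with `cosh ⟨ξ, ·⟩` is a pairing with any test function that agrees with it on a ball
larger than the support. -/
theorem coshPairing_eq_of_eqOn {ξ : Space n} {ρ ρ' : ℝ} (hρ : ρ < ρ') {f : L2 n}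
    (hf : VanishesOutside ρ f) {φ : Space n → ℝ}
    (hφ : ∀ x ∈ Metric.ball (0 : Space n) ρ', φ =ᶠ[𝓝 x] fun y => Real.cosh (inner ℝ ξ y)) :
    coshPairing ξ f = ∫ x, f x * φ x :=
  hf.integral_mul_congr fun x hx =>
    ((hφ x (by simpa using hx.trans_lt hρ)).self_of_nhds).symm

theorem IsWeakWave.hasDerivWithinAt_coshPairing (hw : IsWeakWave r R T w₀ w₁ z w wt)
    (ξ : Space n) {t : ℝ} (ht : t ∈ timeInterval T) :
    HasDerivWithinAt (fun s => coshPairing ξ (w s)) (coshPairing ξ (wt t)) (timeInterval T) t := by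
  obtain ⟨φ, hφ, hφξ⟩ := exists_testFunction_eq_cosh ξ (t + R + 1)
  have hinner (f : L2 n) : innerSL ℝ (hφ.memLp.toLp φ) f = ∫ x, f x * φ x := by
    rw [innerSL_apply_apply, L2.inner_def]
    refine integral_congr_ae ?_
    filter_upwards [hφ.memLp.coeFn_toLp] with x hx
    simp [hx]
  have h := (innerSL ℝ (hφ.memLp.toLp φ)).hasFDerivAt.comp_hasDerivWithinAt t (hw.time_deriv t ht)
  rw [coshPairing_eq_of_eqOn (by linarith) (hw.support_vel t ht) hφξ, ← hinner]
  refine h.congr_of_eventuallyEq ?_ ?_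
  · filter_upwards [eventually_add_lt_add_one t R (timeInterval T),
      self_mem_nhdsWithin] with s hs hsI
    rw [coshPairing_eq_of_eqOn hs (hw.support s hsI) hφξ, ← hinner]; rfl
  · rw [coshPairing_eq_of_eqOn (by linarith) (hw.support t ht) hφξ, ← hinner]; rfl

/-- The weak wave equation tested with the eigenfunction `cosh ⟨ξ, ·⟩` of the Laplacian. -/
theorem IsWeakWave.hasDerivWithinAt_coshPairing_vel (hr : r ≠ 0)
    (hw : IsWeakWave r R T w₀ w₁ z w wt) (ξ : Space n) {t : ℝ} (ht : t ∈ timeInterval T)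
    (hz : VanishesOutside (t + R) (z t)) :
    HasDerivWithinAt (fun s => coshPairing ξ (wt s))
      (‖ξ‖ ^ 2 * coshPairing ξ (w t) + ∫ x, |z t x| ^ r * Real.cosh (inner ℝ ξ x))
      (timeInterval T) t := by
  obtain ⟨φ, hφ, hφξ⟩ := exists_testFunction_eq_cosh ξ (t + R + 1)
  obtain ⟨Dw, hDw, -, -, heq⟩ := hw.equation
  have h := heq φ hφ t ht
  have h1 : ∫ x, w t x * ∑ i, partialDeriv i (partialDeriv i φ) x
      = ‖ξ‖ ^ 2 * coshPairing ξ (w t) := by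
    rw [coshPairing, ← integral_const_mul, (hw.support t ht).integral_mul_congr
      (ψ := fun x => ‖ξ‖ ^ 2 * Real.cosh (inner ℝ ξ x))]
    · exact integral_congr_ae (.of_forall fun x => by ring)
    · intro x hx
      rw [← sum_partialDeriv_cosh]
      have hx' : x ∈ Metric.ball (0 : Space n) (t + R + 1) := by
        rw [mem_ball_zero_iff]; linarith
      exact Finset.sum_congr rfl fun i _ =>
        (partialDeriv_congr (partialDeriv_congr (hφξ x hx') i) i).self_of_nhds
  rw [(hDw t ht).integral_inner_gradient hφ, h1, hz.integral_rpow_mul_congr hr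
    (ψ := fun x => Real.cosh (inner ℝ ξ x))] at h
  · refine h.congr_of_eventuallyEq ?_ ?_
    · filter_upwards [eventually_add_lt_add_one t R (timeInterval T),
      self_mem_nhdsWithin] with s hs hsI
      exact coshPairing_eq_of_eqOn hs (hw.support_vel s hsI) hφξ
    · exact coshPairing_eq_of_eqOn (by linarith) (hw.support_vel t ht) hφξ
  · intro x hx
    exact (hφξ x (by rw [mem_ball_zero_iff]; linarith)).self_of_nhds

/-- On a set of finite measure the `L^p` norm, `p ≤ 2`, is continuous with respect to `L²`. -/
theorem continuous_eLpNorm_restrict {p : ℝ≥0∞} (hp1 : 1 ≤ p) (hp2 : p ≤ 2)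
    {s : Set (Space n)} (hs : volume s ≠ ⊤) :
    Continuous fun f : L2 n => eLpNorm f p (volume.restrict s) := by
  set C : ℝ≥0∞ := (volume.restrict s) Set.univ ^ (1 / p.toReal - 1 / (2 : ℝ≥0∞).toReal) with hC
  have hpt : p ≠ ⊤ := ne_top_of_le_ne_top (by simp) hp2
  have hp0 : 0 < p.toReal := ENNReal.toReal_pos (by positivity) hpt
  have hexp : 0 ≤ 1 / p.toReal - 1 / (2 : ℝ≥0∞).toReal := by
    have : p.toReal ≤ (2 : ℝ≥0∞).toReal := ENNReal.toReal_mono (by simp) hp2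
    linarith [one_div_le_one_div_of_le hp0 this]
  refine continuous_of_le_add_edist C (ENNReal.rpow_ne_top_of_nonneg hexp (by simpa using hs)) ?_
  intro f g
  have hf := (Lp.aestronglyMeasurable f).restrict (s := s)
  have hg := (Lp.aestronglyMeasurable g).restrict (s := s)
  calc eLpNorm f p (volume.restrict s)
      = eLpNorm (⇑g + (⇑f - ⇑g)) p (volume.restrict s) := by congr 1; abel
    _ ≤ eLpNorm g p (volume.restrict s) + eLpNorm (⇑f - ⇑g) p (volume.restrict s) :=
        eLpNorm_add_le hg (hf.sub hg) hp1
    _ ≤ _ := by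
        gcongr
        refine (eLpNorm_le_eLpNorm_mul_rpow_measure_univ hp2 (hf.sub hg)).trans ?_
        rw [mul_comm, Lp.edist_def]
        gcongr
        exact Measure.restrict_le_self

theorem memLp_restrict {p : ℝ≥0∞} (hp2 : p ≤ 2) {s : Set (Space n)} (hs : volume s ≠ ⊤)
    (f : L2 n) : MemLp f p (volume.restrict s) := by
  have : IsFiniteMeasure (volume.restrict s) := ⟨by simpa using hs.lt_top⟩
  exact ((Lp.memLp f).restrict s).mono_exponent hp2

theorem VanishesOutside.setIntegral_eq {ρ ρ' : ℝ} (hρ : ρ < ρ') {f : L2 n}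
    (hf : VanishesOutside ρ f) {F : ℝ → Space n → ℝ} (hF : ∀ x, F 0 x = 0) :
    ∫ x in Metric.ball 0 ρ', F (f x) x = ∫ x, F (f x) x := by
  refine setIntegral_eq_integral_of_ae_compl_eq_zero ?_
  filter_upwards [hf] with x hx hxb
  rw [hx, hF]
  rw [mem_ball_zero_iff, not_lt] at hxb
  linarith

/-- Since `p ≤ 2` and the supports are locally bounded in time, `C(I; L²)` suffices for
`t ↦ ∫ |z(t)|^p` to be continuous. -/
theorem continuousOn_powIntegral {p : ℝ} (hp1 : 1 ≤ p) (hp2 : p ≤ 2) {I : Set ℝ}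
    (hz : ContinuousOn z I) (hs : ∀ t ∈ I, VanishesOutside (t + R) (z t)) :
    ContinuousOn (fun t => powIntegral p (z t)) I := by
  intro t ht
  set B := Metric.ball (0 : Space n) (t + R + 1) with hB
  have hvol : volume B ≠ ⊤ := measure_ball_lt_top.ne
  have hp1' : 1 ≤ ENNReal.ofReal p := by simpa using ENNReal.ofReal_le_ofReal hp1
  have hp2' : ENNReal.ofReal p ≤ 2 := by simpa using ENNReal.ofReal_le_ofReal hp2
  have key (f : L2 n) : ∫ x in B, |f x| ^ p
      = (eLpNorm f (ENNReal.ofReal p) (volume.restrict B)).toReal ^ p := by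
    have hm := memLp_restrict hp2' hvol f
    rw [hm.eLpNorm_eq_integral_rpow_norm (by simp; linarith) (by simp),
      ENNReal.toReal_ofReal (by positivity), ENNReal.toReal_ofReal (by linarith),
      ← Real.rpow_mul (by positivity), inv_mul_cancel₀ (by linarith), Real.rpow_one]
    simp
  have hcont : ContinuousWithinAt (fun s => ∫ x in B, |z s x| ^ p) I t := by
    simp_rw [key]
    refine ContinuousWithinAt.rpow_const ?_ (Or.inr (by linarith))
    have h1 := (continuous_eLpNorm_restrict hp1' hp2' hvol).continuousAt (x := z t)
    have h2 : ContinuousWithinAt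
        (fun s => eLpNorm (z s) (ENNReal.ofReal p) (volume.restrict B)) I t :=
      h1.comp_continuousWithinAt (hz t ht)
    exact (ENNReal.tendsto_toReal (memLp_restrict hp2' hvol (z t)).2.ne).comp h2
  have hF0 (x : Space n) : (fun (y : ℝ) (_ : Space n) => |y| ^ p) 0 x = 0 := by
    simp [Real.zero_rpow (by linarith : p ≠ 0)]
  refine hcont.congr_of_eventuallyEq ?_ ?_
  · filter_upwards [eventually_add_lt_add_one t R I, self_mem_nhdsWithin] with s hs' hsI
    exact ((hs s hsI).setIntegral_eq hs' (F := fun y _ => |y| ^ p) hF0).symm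
  · exact ((hs t ht).setIntegral_eq (by linarith) (F := fun y _ => |y| ^ p) hF0).symm

theorem VanishesOutside.integrable {ρ : ℝ} {f : L2 n} (hf : VanishesOutside ρ f) :
    Integrable (f : Space n → ℝ) := by
  have h : IntegrableOn (f : Space n → ℝ) (Metric.ball 0 (ρ + 1)) := by
    rw [IntegrableOn, ← memLp_one_iff_integrable]
    exact memLp_restrict (by norm_num) measure_ball_lt_top.ne f
  refine h.integrable_of_ae_notMem_eq_zero ?_
  filter_upwards [hf] with x hx hxb
  rw [mem_ball_zero_iff, not_lt] at hxb
  exact hx (by linarith)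

theorem VanishesOutside.integrable_rpow {p ρ : ℝ} (hp0 : 0 < p) (hp2 : p ≤ 2) {f : L2 n}
    (hf : VanishesOutside ρ f) : Integrable (fun x => |f x| ^ p) := by
  have hp2' : ENNReal.ofReal p ≤ 2 := by simpa using ENNReal.ofReal_le_ofReal hp2
  have h : IntegrableOn (fun x => |f x| ^ p) (Metric.ball 0 (ρ + 1)) := by
    have := (memLp_restrict hp2' (measure_ball_lt_top (μ := volume) (x := (0 : Space n))
      (r := ρ + 1)).ne f).integrable_norm_rpow (by simpa using hp0) (by simp)
    simpa [IntegrableOn, ENNReal.toReal_ofReal hp0.le] using this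
  refine h.integrable_of_ae_notMem_eq_zero ?_
  filter_upwards [hf] with x hx hxb
  rw [mem_ball_zero_iff, not_lt] at hxb
  rw [hx (by linarith)]; simp [Real.zero_rpow hp0.ne']

/-! ### Duhamel's inequality -/

theorem timeInterval_mono {s t : ℝ} (h0 : 0 ≤ s) (hst : s ≤ t) (ht : t ∈ timeInterval T) :
    s ∈ timeInterval T :=
  ⟨h0, lt_of_le_of_lt (by exact_mod_cast hst) ht.2⟩

theorem timeInterval_mem_nhds {t : ℝ} (h0 : 0 < t) (ht : t ∈ timeInterval T) :
    timeInterval T ∈ 𝓝 t := by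
  have h2 : ∀ᶠ s : ℝ in 𝓝 t, (s : EReal) < T :=
    (continuous_coe_real_ereal.tendsto t).eventually (eventually_lt_nhds ht.2)
  filter_upwards [eventually_gt_nhds h0, h2] with s hs hs2
  exact ⟨hs.le, hs2⟩

/-- Duhamel's inequality for `E'' ≥ l² E + N` with `E(0), E'(0)` nonnegative. -/
theorem sinh_integral_le_of_hasDerivAt {l t a : ℝ} (hl : 0 < l) (ht : 0 ≤ t)
    {E E' E'' N : ℝ → ℝ} (hE0 : 0 ≤ E 0) (hE'0 : a ≤ E' 0)
    (hEc : ContinuousOn E (Set.Icc 0 t)) (hE'c : ContinuousOn E' (Set.Icc 0 t))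
    (hE : ∀ s ∈ Set.Ioo 0 t, HasDerivAt E (E' s) s)
    (hE' : ∀ s ∈ Set.Ioo 0 t, HasDerivAt E' (E'' s) s)
    (hN : ContinuousOn N (Set.Icc 0 t)) (hNE : ∀ s ∈ Set.Ioo 0 t, l ^ 2 * E s + N s ≤ E'' s) :
    Real.sinh (l * t) / l * a + ∫ s in 0..t, Real.sinh (l * (t - s)) / l * N s ≤ E t := by
  -- the Wronskian of `E` with the solution `sinh (l (t - s)) / l` of the homogeneous equation
  let G : ℝ → ℝ := fun s => E s * Real.cosh (l * (t - s)) + E' s * (Real.sinh (l * (t - s)) / l)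
  have hGc : ContinuousOn G (Set.Icc 0 t) := by
    refine (hEc.mul ?_).add (hE'c.mul ?_) <;> fun_prop
  have hG (s : ℝ) (hs : s ∈ Set.Ioo 0 t) : HasDerivAt G
      ((E'' s - l ^ 2 * E s) * (Real.sinh (l * (t - s)) / l)) s := by
    have hlin : HasDerivAt (fun s => l * (t - s)) (-l) s := by
      simpa using ((hasDerivAt_id s).const_sub t).const_mul l
    have := ((hE s hs).mul hlin.cosh).add ((hE' s hs).mul (hlin.sinh.div_const l))
    refine this.congr_deriv ?_
    field_simp
    ring
  have hint : ContinuousOn (fun s => Real.sinh (l * (t - s)) / l * N s) (Set.Icc 0 t) :=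
    ContinuousOn.mul (by fun_prop) hN
  have h := intervalIntegral.integral_le_sub_of_hasDeriv_right_of_le ht hGc
    (fun s hs => (hG s hs).hasDerivWithinAt) (hint.integrableOn_compact isCompact_Icc)
    (fun s hs => by
      have h1 : 0 ≤ Real.sinh (l * (t - s)) / l :=
        div_nonneg (Real.sinh_nonneg_iff.2 (mul_nonneg hl.le (by linarith [hs.2]))) hl.le
      have := mul_le_mul_of_nonneg_left (le_sub_iff_add_le'.2 (hNE s hs)) h1
      simpa [mul_comm] using this)
  have hGt : G t = E t := by simp [G]
  have hG0 : Real.sinh (l * t) / l * a ≤ G 0 := by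
    have h1 : 0 ≤ Real.sinh (l * t) / l :=
      div_nonneg (Real.sinh_nonneg_iff.2 (mul_nonneg hl.le ht)) hl.le
    have h2 : 0 ≤ E 0 * Real.cosh (l * t) := mul_nonneg hE0 (Real.cosh_pos _).le
    have h3 := mul_le_mul_of_nonneg_left hE'0 h1
    simp only [G, sub_zero]
    linarith
  linarith

theorem L2_ae_nonneg {f : L2 n} (hf : 0 ≤ f) : ∀ᵐ x, 0 ≤ f x := (Lp.coeFn_nonneg f).2 hf

theorem VanishesOutside.integrable_mul_cosh {ρ : ℝ} {f : L2 n} (hf : VanishesOutside ρ f)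
    (ξ : Space n) : Integrable (fun x => f x * Real.cosh (inner ℝ ξ x)) := by
  obtain ⟨φ, hφ, hφξ⟩ := exists_testFunction_eq_cosh ξ (ρ + 1)
  refine (hφ.integrable_mul f).congr ?_
  filter_upwards [hf] with x hx
  by_cases hxr : ‖x‖ ≤ ρ
  · rw [(hφξ x (by rw [mem_ball_zero_iff]; linarith)).self_of_nhds]
  · simp [hx (not_le.1 hxr)]

theorem VanishesOutside.integrable_rpow_mul_cosh {p ρ : ℝ} (hp0 : 0 < p) (hp2 : p ≤ 2) {f : L2 n}
    (hf : VanishesOutside ρ f) (ξ : Space n) :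
    Integrable (fun x => |f x| ^ p * Real.cosh (inner ℝ ξ x)) := by
  refine ((hf.integrable_rpow hp0 hp2).mul_const (Real.cosh (‖ξ‖ * ρ))).mono' ?_ ?_
  · refine AEStronglyMeasurable.mul (hf.integrable_rpow hp0 hp2).1 ?_
    exact (by fun_prop : Continuous fun x : Space n => Real.cosh (inner ℝ ξ x)).aestronglyMeasurable
  · filter_upwards [hf] with x hx
    by_cases hxr : ‖x‖ ≤ ρ
    · rw [Real.norm_of_nonneg (mul_nonneg (by positivity) (Real.cosh_pos _).le)]
      refine mul_le_mul_of_nonneg_left ?_ (by positivity)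
      rw [Real.cosh_le_cosh]
      calc |inner ℝ ξ x| ≤ ‖ξ‖ * ‖x‖ := abs_real_inner_le_norm _ _
        _ ≤ ‖ξ‖ * ρ := by gcongr
        _ ≤ _ := le_abs_self _
    · simp [hx (not_le.1 hxr), Real.zero_rpow hp0.ne']

/-- Duhamel's inequality for the pairing with `cosh ⟨ξ, ·⟩ ≥ 1`. -/
theorem IsWeakWave.coshPairing_ge {p : ℝ} (hp1 : 1 < p) (hp2 : p ≤ 2)
    (hw : IsWeakWave p R T w₀ w₁ z w wt) (h0 : 0 ≤ w₀) (h1 : 0 ≤ w₁)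
    (hzc : ContinuousOn z (timeInterval T))
    (hz : ∀ t ∈ timeInterval T, VanishesOutside (t + R) (z t))
    {ξ : Space n} (hξ : ξ ≠ 0) {t : ℝ} (ht : t ∈ timeInterval T) :
    Real.sinh (‖ξ‖ * t) / ‖ξ‖ * (∫ x, w₁ x)
      + ∫ s in 0..t, Real.sinh (‖ξ‖ * (t - s)) / ‖ξ‖ * powIntegral p (z s)
      ≤ coshPairing ξ (w t) := by
  have hsub : Set.Icc 0 t ⊆ timeInterval T := fun s hs => timeInterval_mono hs.1 hs.2 ht
  have h0I : (0 : ℝ) ∈ timeInterval T := hsub ⟨le_rfl, ht.1⟩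
  have hE := fun s hs => hw.hasDerivWithinAt_coshPairing ξ (t := s) hs
  have hE' := fun s hs => hw.hasDerivWithinAt_coshPairing_vel (by linarith) ξ (t := s) hs (hz s hs)
  have hcosh (f : L2 n) (hf : 0 ≤ f) (hfs : VanishesOutside (0 + R) f) :
      ∫ x, f x ≤ coshPairing ξ f := by
    refine integral_mono_ae hfs.integrable (hfs.integrable_mul_cosh ξ) ?_
    filter_upwards [L2_ae_nonneg hf] with x hx
    exact le_mul_of_one_le_right hx (Real.one_le_cosh _)
  refine sinh_integral_le_of_hasDerivAt (norm_pos_iff.2 hξ) ht.1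
    (E := fun s => coshPairing ξ (w s)) (E' := fun s => coshPairing ξ (wt s))
    (E'' := fun s => ‖ξ‖ ^ 2 * coshPairing ξ (w s) + ∫ x, |z s x| ^ p * Real.cosh (inner ℝ ξ x))
    ?_ ?_ (fun s hs => (hE s (hsub hs)).continuousWithinAt.mono hsub)
    (fun s hs => (hE' s (hsub hs)).continuousWithinAt.mono hsub)
    (fun s hs => (hE s (hsub (Set.Ioo_subset_Icc_self hs))).hasDerivAt
      (timeInterval_mem_nhds hs.1 (hsub (Set.Ioo_subset_Icc_self hs))))
    (fun s hs => (hE' s (hsub (Set.Ioo_subset_Icc_self hs))).hasDerivAt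
      (timeInterval_mem_nhds hs.1 (hsub (Set.Ioo_subset_Icc_self hs))))
    ((continuousOn_powIntegral hp1.le hp2 hzc hz).mono hsub) ?_
  · rw [hw.init_pos]
    have := hw.support 0 h0I
    rw [hw.init_pos] at this
    refine le_trans ?_ (hcosh _ h0 this)
    exact integral_nonneg_of_ae (L2_ae_nonneg h0)
  · have := hw.support_vel 0 h0I
    simp only [hw.init_vel] at this ⊢
    exact hcosh _ h1 this
  · intro s hs
    have hsI := hsub (Set.Ioo_subset_Icc_self hs)
    gcongr
    refine integral_mono ((hz s hsI).integrable_rpow (by linarith) hp2)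
      ((hz s hsI).integrable_rpow_mul_cosh (by linarith) hp2 ξ) fun x => ?_
    exact le_mul_of_one_le_right (by positivity) (Real.one_le_cosh _)

/-! ### The spatial mean -/

/-- Testing with `ξ = 0`: the second derivative of the spatial mean is the source term. -/
theorem IsWeakWave.hasDerivWithinAt_spatialIntegral (hr : r ≠ 0)
    (hw : IsWeakWave r R T w₀ w₁ z w wt)
    (hz : ∀ t ∈ timeInterval T, VanishesOutside (t + R) (z t)) {t : ℝ} (ht : t ∈ timeInterval T) :
    HasDerivWithinAt (spatialIntegral w) (spatialIntegral wt t) (timeInterval T) t ∧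
    HasDerivWithinAt (spatialIntegral wt) (powIntegral r (z t)) (timeInterval T) t := by
  have h (f : L2 n) : coshPairing 0 f = ∫ x, f x := by simp [coshPairing]
  have h1 := hw.hasDerivWithinAt_coshPairing 0 ht
  have h2 := hw.hasDerivWithinAt_coshPairing_vel hr 0 ht (hz t ht)
  simp only [h] at h1 h2
  refine ⟨h1, h2.congr_deriv ?_⟩
  simp [powIntegral]

theorem uniqueDiffOn_timeInterval (hT : 0 < T) : UniqueDiffOn ℝ (timeInterval T) := by
  have hne : ∃ t : ℝ, 0 < t ∧ t ∈ timeInterval T := by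
    obtain ⟨t, ht0, htT⟩ := EReal.lt_iff_exists_real_btwn.1 hT
    exact ⟨t, by exact_mod_cast ht0, by exact_mod_cast ht0.le, htT⟩
  refine uniqueDiffOn_convex ?_ ?_
  · refine Set.OrdConnected.convex ⟨fun x hx y hy s hs => ?_⟩
    exact timeInterval_mono (hx.1.trans hs.1) hs.2 hy
  · obtain ⟨t, ht0, ht⟩ := hne
    exact ⟨t, mem_interior_iff_mem_nhds.2 (timeInterval_mem_nhds ht0 ht)⟩

theorem contDiffOn_two_of_hasDerivWithinAt {s : Set ℝ} (hs : UniqueDiffOn ℝ s) {f f' f'' : ℝ → ℝ}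
    (hf : ∀ t ∈ s, HasDerivWithinAt f (f' t) s t) (hf' : ∀ t ∈ s, HasDerivWithinAt f' (f'' t) s t)
    (hf'' : ContinuousOn f'' s) : ContDiffOn ℝ 2 f s := by
  have h1 : ContDiffOn ℝ 1 f' s := by
    rw [contDiffOn_one_iff_derivWithin hs]
    exact ⟨fun t ht => (hf' t ht).differentiableWithinAt,
      hf''.congr fun t ht => (hf' t ht).derivWithin (hs t ht)⟩
  rw [show (2 : ℕ∞ω) = 1 + 1 by norm_num, contDiffOn_succ_iff_derivWithin hs]
  exact ⟨fun t ht => (hf t ht).differentiableWithinAt, by simp,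
    h1.congr fun t ht => (hf t ht).derivWithin (hs t ht)⟩

theorem IsWeakWave.contDiffOn_spatialIntegral {p : ℝ} (hp1 : 1 < p) (hp2 : p ≤ 2) (hT : 0 < T)
    (hw : IsWeakWave p R T w₀ w₁ z w wt) (hzc : ContinuousOn z (timeInterval T))
    (hz : ∀ t ∈ timeInterval T, VanishesOutside (t + R) (z t)) :
    ContDiffOn ℝ 2 (spatialIntegral w) (timeInterval T) :=
  contDiffOn_two_of_hasDerivWithinAt (uniqueDiffOn_timeInterval hT)
    (fun _ ht => (hw.hasDerivWithinAt_spatialIntegral (by linarith) hz ht).1)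
    (fun _ ht => (hw.hasDerivWithinAt_spatialIntegral (by linarith) hz ht).2)
    (continuousOn_powIntegral hp1.le hp2 hzc hz)

theorem IsWeakWave.deriv_deriv_spatialIntegral (hr : r ≠ 0)
    (hw : IsWeakWave r R T w₀ w₁ z w wt)
    (hz : ∀ t ∈ timeInterval T, VanishesOutside (t + R) (z t)) {t : ℝ} (h0 : 0 < t)
    (ht : t ∈ timeInterval T) : deriv (deriv (spatialIntegral w)) t = powIntegral r (z t) := by
  have hev : deriv (spatialIntegral w) =ᶠ[𝓝 t] spatialIntegral wt := by
    filter_upwards [eventually_gt_nhds h0, timeInterval_mem_nhds h0 ht] with s hs hsI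
    exact ((hw.hasDerivWithinAt_spatialIntegral hr hz hsI).1.hasDerivAt
      (timeInterval_mem_nhds hs hsI)).deriv
  rw [hev.deriv_eq]
  exact ((hw.hasDerivWithinAt_spatialIntegral hr hz ht).2.hasDerivAt
    (timeInterval_mem_nhds h0 ht)).deriv

/-! ### The Gaussian mixture -/

/-- The density in `(θ, ξ)` of the Gaussian mixture: the Gaussians `exp (-‖ξ‖² / (4 θ))` are
superposed with weight `θ^(γ - 1 - n/2) exp (-θ a²)`. -/
noncomputable def mixKernel (n : ℕ) (a γ θ : ℝ) (ξ : Space n) : ℝ :=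
  θ ^ (γ - 1 - n / 2) * Real.exp (-(θ * a ^ 2)) * Real.exp (-(‖ξ‖ ^ 2 / (4 * θ)))

/-- The Gaussian mixture `∫₀^∞ θ^(γ - 1 - n/2) exp (-θ a² - ‖ξ‖² / (4 θ)) dθ`, as a measure
in `ξ`. -/
noncomputable def mixMeasure (n : ℕ) (a γ : ℝ) : Measure (Space n) :=
  volume.withDensity fun ξ => ∫⁻ θ in Set.Ioi 0, ENNReal.ofReal (mixKernel n a γ θ ξ)

theorem measurable_mixKernel (a γ : ℝ) :
    Measurable fun q : Space n × ℝ => mixKernel n a γ q.2 q.1 := by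
  unfold mixKernel; fun_prop

theorem measurable_mixDensity (a γ : ℝ) :
    Measurable fun ξ : Space n => ∫⁻ θ in Set.Ioi 0, ENNReal.ofReal (mixKernel n a γ θ ξ) :=
  (measurable_mixKernel a γ).ennreal_ofReal.lintegral_prod_right'

instance (a γ : ℝ) : SFinite (mixMeasure n a γ) := by unfold mixMeasure; infer_instance

theorem lintegral_mixMeasure (a γ : ℝ) {F : Space n → ℝ≥0∞} (hF : Measurable F) :
    ∫⁻ ξ, F ξ ∂mixMeasure n a γ
      = ∫⁻ ξ, (∫⁻ θ in Set.Ioi 0, ENNReal.ofReal (mixKernel n a γ θ ξ)) * F ξ := by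
  rw [mixMeasure, lintegral_withDensity_eq_lintegral_mul _ (measurable_mixDensity a γ) hF]
  rfl

theorem integral_gaussian_mul_exp {θ : ℝ} (hθ : 0 < θ) (x : Space n) :
    Integrable (fun ξ : Space n => Real.exp (-(‖ξ‖ ^ 2 / (4 * θ))) * Real.exp (inner ℝ x ξ)) ∧
    ∫ ξ : Space n, Real.exp (-(‖ξ‖ ^ 2 / (4 * θ))) * Real.exp (inner ℝ x ξ)
      = (4 * Real.pi * θ) ^ ((n : ℝ) / 2) * Real.exp (θ * ‖x‖ ^ 2) := by
  have hb : 0 < (((1 / (4 * θ) : ℝ)) : ℂ).re := by rw [Complex.ofReal_re]; positivity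
  have h1 := GaussianFourier.integrable_cexp_neg_mul_sq_norm_add hb 1 x
  have h2 := GaussianFourier.integral_cexp_neg_mul_sq_norm_add hb 1 x
  have hfun : (fun ξ : Space n => Complex.exp
      (-((1 / (4 * θ) : ℝ) : ℂ) * (‖ξ‖ : ℂ) ^ 2 + 1 * ((inner ℝ x ξ : ℝ) : ℂ)))
      = fun ξ => ((Real.exp (-(‖ξ‖ ^ 2 / (4 * θ))) * Real.exp (inner ℝ x ξ) : ℝ) : ℂ) := by
    funext ξ
    rw [← Real.exp_add]
    push_cast
    congr 1
    ring
  rw [hfun] at h1 h2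
  refine ⟨by simpa only [RCLike.re_to_complex, Complex.ofReal_re] using h1.re, ?_⟩
  rw [integral_complex_ofReal] at h2
  have h3 : (Real.pi : ℂ) / ((1 / (4 * θ) : ℝ) : ℂ) = ((4 * Real.pi * θ : ℝ) : ℂ) := by
    push_cast
    have : (θ : ℂ) ≠ 0 := by exact_mod_cast hθ.ne'
    field_simp
  have h4 : (1 : ℂ) ^ 2 * (‖x‖ : ℂ) ^ 2 / (4 * ((1 / (4 * θ) : ℝ) : ℂ))
      = ((θ * ‖x‖ ^ 2 : ℝ) : ℂ) := by
    push_cast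
    have : (θ : ℂ) ≠ 0 := by exact_mod_cast hθ.ne'
    field_simp
  rw [h3, h4, finrank_euclideanSpace_fin, ← Complex.ofReal_exp,
    show ((n : ℂ) / 2) = (((n : ℝ) / 2 : ℝ) : ℂ) by push_cast; rfl,
    ← Complex.ofReal_cpow (by positivity)] at h2
  exact_mod_cast h2

theorem integral_gaussian_mul_cosh {θ : ℝ} (hθ : 0 < θ) (x : Space n) :
    Integrable (fun ξ : Space n => Real.exp (-(‖ξ‖ ^ 2 / (4 * θ))) * Real.cosh (inner ℝ ξ x)) ∧
    ∫ ξ : Space n, Real.exp (-(‖ξ‖ ^ 2 / (4 * θ))) * Real.cosh (inner ℝ ξ x)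
      = (4 * Real.pi * θ) ^ ((n : ℝ) / 2) * Real.exp (θ * ‖x‖ ^ 2) := by
  obtain ⟨i1, e1⟩ := integral_gaussian_mul_exp hθ x
  obtain ⟨i2, e2⟩ := integral_gaussian_mul_exp hθ (-x)
  have hfun : (fun ξ : Space n => Real.exp (-(‖ξ‖ ^ 2 / (4 * θ))) * Real.cosh (inner ℝ ξ x))
      = fun ξ => (Real.exp (-(‖ξ‖ ^ 2 / (4 * θ))) * Real.exp (inner ℝ x ξ)
        + Real.exp (-(‖ξ‖ ^ 2 / (4 * θ))) * Real.exp (inner ℝ (-x) ξ)) / 2 := by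
    funext ξ
    rw [Real.cosh_eq, inner_neg_left, real_inner_comm]
    ring
  rw [hfun]
  refine ⟨(i1.add i2).div_const 2, ?_⟩
  rw [integral_div, integral_add i1 i2, e1, e2, norm_neg]
  ring

/-- The constant in `lintegral_cosh_mixMeasure`. -/
noncomputable def mixConst (n : ℕ) (γ : ℝ) : ℝ := (4 * Real.pi) ^ ((n : ℝ) / 2) * Real.Gamma γ

theorem mixConst_pos {γ : ℝ} (hγ : 0 < γ) : 0 < mixConst n γ :=
  mul_pos (by positivity) (Real.Gamma_pos_of_pos hγ)

/-- The superposition of the eigenfunctions `cosh ⟨ξ, x⟩` against the Gaussian mixture is an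
explicit negative power of `a² - ‖x‖²`. -/
theorem lintegral_cosh_mixMeasure {a γ : ℝ} (hγ : 0 < γ) {x : Space n} (hx : ‖x‖ < a) :
    ∫⁻ ξ, ENNReal.ofReal (Real.cosh (inner ℝ ξ x)) ∂mixMeasure n a γ
      = ENNReal.ofReal (mixConst n γ * (a ^ 2 - ‖x‖ ^ 2) ^ (-γ)) := by
  have hd : 0 < a ^ 2 - ‖x‖ ^ 2 := by nlinarith [norm_nonneg x]
  have hmeas : Measurable fun ξ : Space n => ENNReal.ofReal (Real.cosh (inner ℝ ξ x)) := by
    fun_prop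
  rw [lintegral_mixMeasure _ _ hmeas]
  have h1 (ξ : Space n) : (∫⁻ θ in Set.Ioi 0, ENNReal.ofReal (mixKernel n a γ θ ξ))
        * ENNReal.ofReal (Real.cosh (inner ℝ ξ x))
      = ∫⁻ θ in Set.Ioi 0, ENNReal.ofReal (mixKernel n a γ θ ξ)
        * ENNReal.ofReal (Real.cosh (inner ℝ ξ x)) := by
    rw [lintegral_mul_const]
    exact (measurable_mixKernel a γ).ennreal_ofReal.comp measurable_prodMk_left
  simp_rw [h1]
  rw [lintegral_lintegral_swap]
  swap
  · refine Measurable.aemeasurable ?_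
    exact (measurable_mixKernel a γ).ennreal_ofReal.mul (hmeas.comp measurable_fst)
  have h2 (θ : ℝ) (hθ : θ ∈ Set.Ioi (0 : ℝ)) :
      ∫⁻ ξ : Space n, ENNReal.ofReal (mixKernel n a γ θ ξ)
        * ENNReal.ofReal (Real.cosh (inner ℝ ξ x))
      = ENNReal.ofReal ((4 * Real.pi) ^ ((n : ℝ) / 2)
          * (θ ^ (γ - 1) * Real.exp (-((a ^ 2 - ‖x‖ ^ 2) * θ)))) := by
    have hθ : 0 < θ := hθ
    obtain ⟨hi, he⟩ := integral_gaussian_mul_cosh hθ x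
    have hk (ξ : Space n) : ENNReal.ofReal (mixKernel n a γ θ ξ)
        * ENNReal.ofReal (Real.cosh (inner ℝ ξ x))
        = ENNReal.ofReal (θ ^ (γ - 1 - n / 2) * Real.exp (-(θ * a ^ 2))
          * (Real.exp (-(‖ξ‖ ^ 2 / (4 * θ))) * Real.cosh (inner ℝ ξ x))) := by
      rw [← ENNReal.ofReal_mul (by unfold mixKernel; positivity), mixKernel, mul_assoc]
    simp_rw [hk]
    rw [← ofReal_integral_eq_lintegral_ofReal (hi.const_mul _)
      (.of_forall fun ξ => mul_nonneg (by positivity)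
        (mul_nonneg (by positivity) (Real.cosh_pos _).le)), integral_const_mul, he]
    congr 1
    rw [Real.mul_rpow (by positivity) hθ.le]
    have e1 : θ ^ (γ - 1) = θ ^ (γ - 1 - n / 2) * θ ^ ((n : ℝ) / 2) := by
      rw [← Real.rpow_add hθ]; congr 1; ring
    have e2 : Real.exp (-((a ^ 2 - ‖x‖ ^ 2) * θ))
        = Real.exp (-(θ * a ^ 2)) * Real.exp (θ * ‖x‖ ^ 2) := by
      rw [← Real.exp_add]; congr 1; ring
    rw [e1, e2]
    ring
  rw [setLIntegral_congr_fun measurableSet_Ioi h2, ← ofReal_integral_eq_lintegral_ofReal]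
  · rw [integral_const_mul, Real.integral_rpow_mul_exp_neg_mul_Ioi hγ hd, mixConst,
      one_div, Real.inv_rpow hd.le, Real.rpow_neg hd.le]
    congr 1
    ring
  · refine Integrable.const_mul ?_ _
    have := integrableOn_rpow_mul_exp_neg_mul_rpow (s := γ - 1) (p := 1) (by linarith)
      one_pos hd
    simpa only [IntegrableOn, Real.rpow_one, neg_mul] using this
  · filter_upwards [ae_restrict_mem measurableSet_Ioi] with θ hθ
    have hθ : 0 < θ := hθ
    positivity

/-- Laplace's method at the saddle point `θ = l / (2 a)` bounds the mixture density from below. -/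
theorem mixDensity_ge {a γ : ℝ} (ha : 0 < a) (hγ : γ ≤ 1 + n / 2) {ξ : Space n}
    (hξ : 1 ≤ ‖ξ‖ * a) :
    ENNReal.ofReal ((‖ξ‖ / a) ^ (γ - 1 - n / 2) * (‖ξ‖ / (2 * a)) * (‖ξ‖ * a) ^ (-(1 / 2) : ℝ)
        * Real.exp (-(a * ‖ξ‖) - 1 / 2))
      ≤ ∫⁻ θ in Set.Ioi 0, ENNReal.ofReal (mixKernel n a γ θ ξ) := by
  set l := ‖ξ‖ with hl
  have hl0 : 0 < l := by
    by_contra h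
    nlinarith
  set h : ℝ := (l * a) ^ (-(1 / 2) : ℝ) with hh
  have hpos : 0 < h := by positivity
  have hh1 : h ≤ 1 := Real.rpow_le_one_of_one_le_of_nonpos hξ (by norm_num)
  have hh2 : h ^ 2 * (l * a) = 1 := by
    rw [hh, ← Real.rpow_natCast, ← Real.rpow_mul (by positivity)]
    norm_num
    rw [Real.rpow_neg_one]
    field_simp
  set θ₀ : ℝ := l / (2 * a) with hθ₀
  have hθ₀pos : 0 < θ₀ := by positivity
  have hsub : Set.Icc θ₀ (θ₀ + θ₀ * h) ⊆ Set.Ioi 0 := fun θ hθ => hθ₀pos.trans_le hθ.1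
  set c : ℝ := (l / a) ^ (γ - 1 - n / 2) * Real.exp (-(a * l) - 1 / 2) with hc
  have hle (θ : ℝ) (hθ : θ ∈ Set.Icc θ₀ (θ₀ + θ₀ * h)) : c ≤ mixKernel n a γ θ ξ := by
    have hθ0 : 0 < θ := hsub hθ
    rw [mixKernel, mul_assoc, ← Real.exp_add, hc, ← hl]
    refine mul_le_mul ?_ (Real.exp_le_exp.2 ?_) (by positivity) (by positivity)
    · refine Real.rpow_le_rpow_of_nonpos hθ0 ?_ (by linarith)
      have : θ₀ * h ≤ θ₀ := mul_le_of_le_one_right hθ₀pos.le hh1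
      have h2 : l / a = 2 * θ₀ := by rw [hθ₀]; field_simp
      linarith [hθ.2]
    · -- complete the square around the saddle point
      have hlθ : l = 2 * a * θ₀ := by rw [hθ₀]; field_simp
      have hsq : θ * a ^ 2 + l ^ 2 / (4 * θ) - a * l = a ^ 2 * (θ - θ₀) ^ 2 / θ := by
        rw [hlθ]; field_simp; ring
      have hb : a ^ 2 * (θ - θ₀) ^ 2 / θ ≤ 1 / 2 := by
        rw [div_le_iff₀ hθ0]
        have h1 : (θ - θ₀) ^ 2 ≤ (θ₀ * h) ^ 2 :=
          pow_le_pow_left₀ (by linarith [hθ.1]) (by linarith [hθ.2]) 2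
        have h3 : a ^ 2 * (θ₀ * h) ^ 2 = θ₀ / 2 := by
          have : h ^ 2 * (2 * a * θ₀ * a) = 1 := by rw [← hlθ]; exact hh2
          nlinarith
        nlinarith [hθ.1, sq_nonneg a]
      linarith
  calc ENNReal.ofReal ((l / a) ^ (γ - 1 - n / 2) * θ₀ * h * Real.exp (-(a * l) - 1 / 2))
      = ENNReal.ofReal c * volume (Set.Icc θ₀ (θ₀ + θ₀ * h)) := by
        rw [Real.volume_Icc, ← ENNReal.ofReal_mul (by positivity)]
        congr 1
        rw [hc]; ring
    _ = ∫⁻ _ in Set.Icc θ₀ (θ₀ + θ₀ * h), ENNReal.ofReal c := by rw [setLIntegral_const]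
    _ ≤ ∫⁻ θ in Set.Icc θ₀ (θ₀ + θ₀ * h), ENNReal.ofReal (mixKernel n a γ θ ξ) :=
        setLIntegral_mono' measurableSet_Icc fun θ hθ => ENNReal.ofReal_le_ofReal (hle θ hθ)
    _ ≤ _ := lintegral_mono_set hsub

/-- At frequencies `l ∼ 1 / ρ` the product `exp (-a l) sinh (l (a - ρ)) ∼ exp (-l ρ)` is bounded
below. -/
theorem exp_neg_mul_sinh_ge {a ρ l : ℝ} (hρ : 0 < ρ) (haρ : 6 * ρ ≤ 5 * a) (h1 : 1 ≤ l * ρ)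
    (h2 : l * ρ ≤ 2) :
    Real.exp (-2) * (1 - Real.exp (-(2 / 5))) / 2
      ≤ Real.exp (-(a * l)) * Real.sinh (l * (a - ρ)) := by
  have hl : 0 < l := by
    by_contra h
    nlinarith
  have h3 : 1 / 5 ≤ l * (a - ρ) := by nlinarith
  have : Real.exp (-(a * l)) * Real.sinh (l * (a - ρ))
      = Real.exp (-(l * ρ)) * (1 - Real.exp (-(2 * (l * (a - ρ))))) / 2 := by
    have e1 : Real.exp (-(l * ρ)) = Real.exp (-(a * l)) * Real.exp (l * (a - ρ)) := by
      rw [← Real.exp_add]; congr 1; ring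
    have e2 : Real.exp (l * (a - ρ)) * Real.exp (-(2 * (l * (a - ρ))))
        = Real.exp (-(l * (a - ρ))) := by
      rw [← Real.exp_add]; congr 1; ring
    rw [Real.sinh_eq, e1, ← e2]; ring
  rw [this]
  have h4 : 0 ≤ 1 - Real.exp (-(2 / 5)) := by
    rw [sub_nonneg, Real.exp_le_one_iff]; norm_num
  gcongr
  linarith

/-- Lower bound for the superposed Duhamel kernel, from the frequencies `‖ξ‖ ∼ 1 / ρ`. -/
theorem exists_lintegral_sinh_mixMeasure_ge (hn : 1 ≤ n) {γ : ℝ} (hγ : γ ≤ 1 + n / 2) :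
    ∃ c : ℝ, 0 < c ∧ ∀ a ρ : ℝ, 0 < ρ → 6 * ρ ≤ 5 * a →
      ENNReal.ofReal (c * ρ ^ (-(((n : ℝ) - 3) / 2 + γ)) * a ^ (((n : ℝ) - 1) / 2 - γ))
        ≤ ∫⁻ ξ, ENNReal.ofReal (Real.sinh (‖ξ‖ * (a - ρ)) / ‖ξ‖) ∂mixMeasure n a γ := by
  set β : ℝ := γ - 1 - n / 2 with hβ
  set e₀ : ℝ := Real.exp (-2) * (1 - Real.exp (-(2 / 5))) / 2 with he₀
  have he₀pos : 0 < e₀ := by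
    have : Real.exp (-(2 / 5)) < 1 := by rw [Real.exp_lt_one_iff]; norm_num
    have : 0 < 1 - Real.exp (-(2 / 5)) := by linarith
    positivity
  set V₁ : ℝ := (volume : Measure (Space n)).real (Metric.ball 0 1) with hV
  have hVpos : 0 < V₁ :=
    ENNReal.toReal_pos (Metric.measure_ball_pos _ _ one_pos).ne' measure_ball_lt_top.ne
  refine ⟨2 ^ β * (1 / 2) * 2 ^ (-(1 / 2) : ℝ) * Real.exp (-(1 / 2)) * e₀ * ((1 / 2) ^ n * V₁),
    by positivity, fun a ρ hρ haρ => ?_⟩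
  have ha : 0 < a := by linarith
  let i₀ : Fin n := ⟨0, hn⟩
  let y : Space n := EuclideanSpace.single i₀ (3 / (2 * ρ))
  have hy : ‖y‖ = 3 / (2 * ρ) := by
    simp only [y, EuclideanSpace.single, PiLp.norm_single]
    exact Real.norm_of_nonneg (by positivity)
  set B := Metric.ball y (1 / (2 * ρ)) with hB
  have hBvol : volume B = ENNReal.ofReal ((1 / (2 * ρ)) ^ n * V₁) := by
    rw [hB, Measure.addHaar_ball_of_pos _ _ (by positivity), finrank_euclideanSpace_fin,
      ENNReal.ofReal_mul (by positivity), hV, measureReal_def,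
      ENNReal.ofReal_toReal measure_ball_lt_top.ne]
  set K : ℝ := (2 / ρ / a) ^ β * (1 / (2 * a)) * (2 / ρ * a) ^ (-(1 / 2) : ℝ)
    * Real.exp (-(1 / 2)) * e₀ with hK
  have hKle (ξ : Space n) (hξ : ξ ∈ B) : ENNReal.ofReal K
      ≤ (∫⁻ θ in Set.Ioi 0, ENNReal.ofReal (mixKernel n a γ θ ξ))
        * ENNReal.ofReal (Real.sinh (‖ξ‖ * (a - ρ)) / ‖ξ‖) := by
    have hd : |‖ξ‖ - ‖y‖| < 1 / (2 * ρ) :=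
      (abs_norm_sub_norm_le ξ y).trans_lt (by simpa [hB, dist_eq_norm] using hξ)
    rw [hy, abs_lt] at hd
    have e1 : 3 / (2 * ρ) - 1 / (2 * ρ) = 1 / ρ := by field_simp; norm_num
    have e2 : 3 / (2 * ρ) + 1 / (2 * ρ) = 2 / ρ := by field_simp; norm_num
    have hl1 : 1 / ρ ≤ ‖ξ‖ := by linarith [hd.1]
    have hl2 : ‖ξ‖ ≤ 2 / ρ := by linarith [hd.2]
    have hl0 : 0 < ‖ξ‖ := lt_of_lt_of_le (by positivity) hl1
    have h1 : 1 ≤ ‖ξ‖ * ρ := by rwa [div_le_iff₀ hρ] at hl1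
    have h2 : ‖ξ‖ * ρ ≤ 2 := by rwa [le_div_iff₀ hρ] at hl2
    refine le_trans ?_ (mul_le_mul_left (mixDensity_ge ha hγ (by nlinarith)) _)
    rw [← ENNReal.ofReal_mul (by positivity)]
    refine ENNReal.ofReal_le_ofReal ?_
    have h3 := exp_neg_mul_sinh_ge hρ haρ h1 h2
    have e3 : Real.exp (-(a * ‖ξ‖) - 1 / 2) = Real.exp (-(1 / 2)) * Real.exp (-(a * ‖ξ‖)) := by
      rw [← Real.exp_add]; congr 1; ring
    calc K ≤ (‖ξ‖ / a) ^ β * (1 / (2 * a)) * (‖ξ‖ * a) ^ (-(1 / 2) : ℝ) * Real.exp (-(1 / 2))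
          * (Real.exp (-(a * ‖ξ‖)) * Real.sinh (‖ξ‖ * (a - ρ))) := by
          rw [hK]
          have g1 : (2 / ρ / a) ^ β ≤ (‖ξ‖ / a) ^ β :=
            Real.rpow_le_rpow_of_nonpos (by positivity) (by gcongr) (by rw [hβ]; linarith)
          have g2 : (2 / ρ * a) ^ (-(1 / 2) : ℝ) ≤ (‖ξ‖ * a) ^ (-(1 / 2) : ℝ) :=
            Real.rpow_le_rpow_of_nonpos (by positivity) (by gcongr) (by norm_num)
          gcongr
      _ = _ := by
          rw [e3, ← hβ]
          clear_value β
          field_simp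
  have hmeas : Measurable fun ξ : Space n =>
      ENNReal.ofReal (Real.sinh (‖ξ‖ * (a - ρ)) / ‖ξ‖) := by fun_prop
  rw [lintegral_mixMeasure _ _ hmeas]
  refine le_trans ?_ 
    ((setLIntegral_mono' measurableSet_ball hKle).trans (setLIntegral_le_lintegral _ _))
  rw [setLIntegral_const, hBvol, ← ENNReal.ofReal_mul (by positivity)]
  refine ENNReal.ofReal_le_ofReal (le_of_eq ?_)
  have p1 : (2 / ρ / a) ^ β = 2 ^ β * (ρ ^ (-β) * a ^ (-β)) := by
    rw [div_div, Real.div_rpow (by norm_num) (by positivity), Real.mul_rpow hρ.le ha.le,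
      Real.rpow_neg hρ.le, Real.rpow_neg ha.le]
    field_simp
  have p2 : (2 / ρ * a) ^ (-(1 / 2) : ℝ)
      = 2 ^ (-(1 / 2) : ℝ) * (ρ ^ (1 / 2 : ℝ) * a ^ (-(1 / 2) : ℝ)) := by
    rw [Real.mul_rpow (by positivity) ha.le, Real.div_rpow (by norm_num) hρ.le,
      Real.rpow_neg hρ.le (1 / 2)]
    field_simp
  have p3 : 1 / (2 * a) = 1 / 2 * a ^ (-1 : ℝ) := by rw [Real.rpow_neg_one]; field_simp
  have p4 : (1 / (2 * ρ)) ^ n = (1 / 2) ^ n * ρ ^ (-(n : ℝ)) := by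
    rw [Real.rpow_neg hρ.le, Real.rpow_natCast, ← inv_pow, ← mul_pow]
    congr 1
    field_simp
  have q1 : ρ ^ (-(((n : ℝ) - 3) / 2 + γ)) = ρ ^ (-β) * ρ ^ (1 / 2 : ℝ) * ρ ^ (-(n : ℝ)) := by
    rw [← Real.rpow_add hρ, ← Real.rpow_add hρ]; congr 1; rw [hβ]; ring
  have q2 : a ^ (((n : ℝ) - 1) / 2 - γ) = a ^ (-β) * a ^ (-1 : ℝ) * a ^ (-(1 / 2) : ℝ) := by
    rw [← Real.rpow_add ha, ← Real.rpow_add ha]; congr 1; rw [hβ]; ring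
  rw [hK, p1, p2, p3, p4, q1, q2]
  ring

/-! ### Superposition of the pairings -/

/-- The explicit superposition of the eigenfunctions `cosh ⟨ξ, ·⟩` obtained from the Gaussian
mixture, concentrated near the light cone `‖x‖ = a`. -/
noncomputable def coneWeight (n : ℕ) (a γ : ℝ) (x : Space n) : ℝ :=
  mixConst n γ * (a ^ 2 - ‖x‖ ^ 2) ^ (-γ)

theorem measurable_coneWeight (a γ : ℝ) : Measurable (coneWeight n a γ) := by
  unfold coneWeight; fun_prop

theorem coneWeight_nonneg {a γ : ℝ} (hγ : 0 < γ) {x : Space n} (hx : ‖x‖ ≤ a) :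
    0 ≤ coneWeight n a γ x := by
  have : 0 ≤ a ^ 2 - ‖x‖ ^ 2 := by nlinarith [norm_nonneg x]
  exact mul_nonneg (mixConst_pos hγ).le (Real.rpow_nonneg this _)

theorem coneWeight_le {a γ ρ : ℝ} (hγ : 0 < γ) (hρ : ρ < a) {x : Space n} (hx : ‖x‖ ≤ ρ) :
    coneWeight n a γ x ≤ mixConst n γ * (a ^ 2 - ρ ^ 2) ^ (-γ) := by
  refine mul_le_mul_of_nonneg_left ?_ (mixConst_pos hγ).le
  have := norm_nonneg x
  exact Real.rpow_le_rpow_of_nonpos (by nlinarith) (by nlinarith) (by linarith)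

theorem integrable_cosh_mixMeasure {a γ : ℝ} (hγ : 0 < γ) {x : Space n} (hx : ‖x‖ < a) :
    Integrable (fun ξ => Real.cosh (inner ℝ ξ x)) (mixMeasure n a γ) := by
  have hc : Continuous fun ξ : Space n => Real.cosh (inner ℝ ξ x) := by fun_prop
  refine ⟨hc.aestronglyMeasurable, ?_⟩
  rw [hasFiniteIntegral_iff_ofReal (.of_forall fun ξ => (Real.cosh_pos _).le),
    lintegral_cosh_mixMeasure hγ hx]
  exact ENNReal.ofReal_lt_top

theorem integral_cosh_mixMeasure {a γ : ℝ} (hγ : 0 < γ) {x : Space n} (hx : ‖x‖ < a) :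
    ∫ ξ, Real.cosh (inner ℝ ξ x) ∂mixMeasure n a γ = coneWeight n a γ x := by
  rw [integral_eq_lintegral_of_nonneg_ae (.of_forall fun ξ => (Real.cosh_pos _).le)
    (integrable_cosh_mixMeasure hγ hx).1, lintegral_cosh_mixMeasure hγ hx,
    ← coneWeight, ENNReal.toReal_ofReal (coneWeight_nonneg hγ hx.le)]

/-- Fubini: superposing the pairings with `cosh ⟨ξ, ·⟩` gives the pairing with `coneWeight`. -/
theorem lintegral_le_integral_mul_coneWeight (hn : 1 ≤ n) {a γ ρ : ℝ} (hγ : 0 < γ) (hρ : ρ < a)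
    {f : L2 n} (hf : VanishesOutside ρ f) (h0 : ∀ ξ, ξ ≠ 0 → 0 ≤ coshPairing ξ f)
    {h : Space n → ℝ≥0∞} (hh : ∀ ξ, ξ ≠ 0 → h ξ ≤ ENNReal.ofReal (coshPairing ξ f)) :
    0 ≤ ∫ x, f x * coneWeight n a γ x ∧
    ∫⁻ ξ, h ξ ∂mixMeasure n a γ ≤ ENNReal.ofReal (∫ x, f x * coneWeight n a γ x) := by
  set μ := mixMeasure n a γ with hμ
  have : Nonempty (Fin n) := ⟨⟨0, hn⟩⟩
  have hnt : Nontrivial (Space n) :=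
    Module.nontrivial_of_finrank_pos (R := ℝ) (by rw [finrank_euclideanSpace_fin]; omega)
  have hne : ∀ᵐ ξ ∂μ, ξ ≠ 0 :=
    (withDensity_absolutelyContinuous volume _).ae_le (Measure.ae_ne volume (0 : Space n))
  have hmeas : AEStronglyMeasurable
      (fun q : Space n × Space n => f q.1 * Real.cosh (inner ℝ q.2 q.1)) (volume.prod μ) := by
    refine AEStronglyMeasurable.mul (Lp.aestronglyMeasurable f).comp_fst ?_
    exact (by fun_prop : Continuous fun q : Space n × Space n =>
      Real.cosh (inner ℝ q.2 q.1)).aestronglyMeasurable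
  have hint : Integrable (fun q : Space n × Space n => f q.1 * Real.cosh (inner ℝ q.2 q.1))
      (volume.prod μ) := by
    rw [integrable_prod_iff hmeas]
    constructor
    · filter_upwards [hf] with x hx
      by_cases hxr : ‖x‖ ≤ ρ
      · exact (integrable_cosh_mixMeasure hγ (hxr.trans_lt hρ)).const_mul _
      · simp [hx (not_le.1 hxr)]
    · refine (hf.integrable.norm.mul_const (mixConst n γ * (a ^ 2 - ρ ^ 2) ^ (-γ))).mono'
        hmeas.norm.integral_prod_right' ?_
      filter_upwards [hf] with x hx
      rw [Real.norm_of_nonneg (integral_nonneg fun _ => norm_nonneg _)]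
      by_cases hxr : ‖x‖ ≤ ρ
      · simp_rw [norm_mul, Real.norm_of_nonneg (Real.cosh_pos _).le]
        rw [integral_const_mul, integral_cosh_mixMeasure hγ (hxr.trans_lt hρ)]
        exact mul_le_mul_of_nonneg_left (coneWeight_le hγ hρ hxr) (norm_nonneg _)
      · simp [hx (not_le.1 hxr)]
  have hswap : ∫ ξ, coshPairing ξ f ∂μ = ∫ x, f x * coneWeight n a γ x := by
    unfold coshPairing
    rw [← integral_integral_swap hint]
    refine integral_congr_ae ?_
    filter_upwards [hf] with x hx
    by_cases hxr : ‖x‖ ≤ ρ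
    · rw [integral_const_mul, integral_cosh_mixMeasure hγ (hxr.trans_lt hρ)]
    · simp [hx (not_le.1 hxr)]
  have hFint : Integrable (fun ξ => coshPairing ξ f) μ := hint.integral_prod_right
  refine ⟨hswap ▸ integral_nonneg_of_ae (hne.mono h0), ?_⟩
  calc ∫⁻ ξ, h ξ ∂μ ≤ ∫⁻ ξ, ENNReal.ofReal (coshPairing ξ f) ∂μ :=
        lintegral_mono_ae (hne.mono hh)
    _ = ENNReal.ofReal (∫ ξ, coshPairing ξ f ∂μ) :=
        (ofReal_integral_eq_lintegral_ofReal hFint (hne.mono h0)).symm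
    _ = _ := by rw [hswap]

/-- The two lower bounds for the weighted mean of a solution: from the initial velocity and from
the source term at times up to `t / 2`. -/
theorem exists_integral_mul_coneWeight_ge (hn : 1 ≤ n) (hp1 : 1 < p) (hp2 : p ≤ 2) {γ : ℝ}
    (hγ0 : 0 < γ) (hγ : γ ≤ 1 + n / 2) :
    ∃ c : ℝ, 0 < c ∧ ∀ (R : ℝ) (T : EReal) (w₀ w₁ : L2 n) (z w wt : ℝ → L2 n), 0 < R →
      IsWeakWave p R T w₀ w₁ z w wt → 0 ≤ w₀ → 0 ≤ w₁ → ContinuousOn z (timeInterval T) →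
      (∀ t ∈ timeInterval T, VanishesOutside (t + R) (z t)) →
      ∀ t ∈ timeInterval T,
      (R / 2 ≤ t → c * (t + 2 * R) ^ (((n : ℝ) - 1) / 2 - γ) *
          ((2 * R) ^ (-(((n : ℝ) - 3) / 2 + γ)) * ∫ x, w₁ x)
        ≤ ∫ x, w t x * coneWeight n (t + 2 * R) γ x) ∧
      (R ≤ t → c * (t + 2 * R) ^ (((n : ℝ) - 1) / 2 - γ) *
          ∫ s in 0..t / 2, (s + 2 * R) ^ (-(((n : ℝ) - 3) / 2 + γ)) * powIntegral p (z s)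
        ≤ ∫ x, w t x * coneWeight n (t + 2 * R) γ x) := by
  obtain ⟨c, hc, hker⟩ := exists_lintegral_sinh_mixMeasure_ge hn hγ
  refine ⟨c, hc, fun R T w₀ w₁ z w wt hR hw h0 h1 hzc hz t ht => ?_⟩
  set a := t + 2 * R with ha
  set q : ℝ := -(((n : ℝ) - 3) / 2 + γ) with hq
  set e : ℝ := ((n : ℝ) - 1) / 2 - γ with he
  have ht0 : 0 ≤ t := ht.1
  have hga (ξ : Space n) (hξ : ξ ≠ 0) :=
    hw.coshPairing_ge hp1 hp2 h0 h1 hzc hz hξ ht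
  have hw₁ : 0 ≤ ∫ x, w₁ x := integral_nonneg_of_ae (L2_ae_nonneg h1)
  have hsinh (l s : ℝ) (hl : 0 ≤ l) (hs : 0 ≤ s) : 0 ≤ Real.sinh (l * s) / l :=
    div_nonneg (Real.sinh_nonneg_iff.2 (mul_nonneg hl hs)) hl
  have hA (ξ : Space n) : 0 ≤ Real.sinh (‖ξ‖ * t) / ‖ξ‖ * ∫ x, w₁ x :=
    mul_nonneg (hsinh _ _ (norm_nonneg _) ht0) hw₁
  have hterm (ξ : Space n) (s : ℝ) (hs : s ≤ t) :
      0 ≤ Real.sinh (‖ξ‖ * (t - s)) / ‖ξ‖ * powIntegral p (z s) :=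
    mul_nonneg (hsinh _ _ (norm_nonneg _) (by linarith)) (powIntegral_nonneg _ _)
  have hB (ξ : Space n) :
      0 ≤ ∫ s in 0..t, Real.sinh (‖ξ‖ * (t - s)) / ‖ξ‖ * powIntegral p (z s) :=
    intervalIntegral.integral_nonneg ht0 fun s hs => hterm ξ s hs.2
  have hpos (ξ : Space n) (hξ : ξ ≠ 0) : 0 ≤ coshPairing ξ (w t) := by
    linarith [hga ξ hξ, hA ξ, hB ξ]
  have hIcc : Set.Icc 0 t ⊆ timeInterval T := fun s hs => timeInterval_mono hs.1 hs.2 ht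
  have hNc : ContinuousOn (fun s => powIntegral p (z s)) (Set.Icc 0 t) :=
    (continuousOn_powIntegral hp1.le hp2 hzc hz).mono hIcc
  constructor
  · intro htR
    obtain ⟨h1', h2⟩ := lintegral_le_integral_mul_coneWeight hn hγ0 (by linarith : t + R < a)
      (hw.support t ht) hpos
      (h := fun ξ => ENNReal.ofReal (Real.sinh (‖ξ‖ * t) / ‖ξ‖) * ENNReal.ofReal (∫ x, w₁ x))
      (fun ξ hξ => by
        rw [← ENNReal.ofReal_mul (hsinh _ _ (norm_nonneg _) ht0)]
        exact ENNReal.ofReal_le_ofReal (by linarith [hga ξ hξ, hB ξ]))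
    rw [lintegral_mul_const _ (by fun_prop)] at h2
    have h3 := hker a (2 * R) (by linarith) (by linarith)
    rw [show a - 2 * R = t by rw [ha]; ring] at h3
    have h4 := (mul_le_mul_left h3 _).trans h2
    rw [← ENNReal.ofReal_mul (by positivity), ENNReal.ofReal_le_ofReal_iff h1'] at h4
    linarith
  · intro htR
    set ν := (volume : Measure ℝ).restrict (Set.Ioc 0 (t / 2)) with hν
    have hsub : Set.Icc 0 (t / 2) ⊆ Set.Icc 0 t := Set.Icc_subset_Icc_right (by linarith)
    have hνmem : ∀ᵐ s ∂ν, s ∈ Set.Ioc 0 (t / 2) := ae_restrict_mem measurableSet_Ioc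
    have hNc' := hNc.mono hsub
    have hNmeas : AEMeasurable (fun s => powIntegral p (z s)) ν :=
      (hNc'.mono Set.Ioc_subset_Icc_self).aemeasurable measurableSet_Ioc
    -- Tonelli for the Duhamel term, restricted to times `s ≤ t / 2`
    have hDuh (ξ : Space n) : ∫⁻ s, ENNReal.ofReal (Real.sinh (‖ξ‖ * (t - s)) / ‖ξ‖)
          * ENNReal.ofReal (powIntegral p (z s)) ∂ν
        ≤ ENNReal.ofReal (∫ s in 0..t, Real.sinh (‖ξ‖ * (t - s)) / ‖ξ‖ * powIntegral p (z s)) := by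
      have hcont : ContinuousOn
          (fun s => Real.sinh (‖ξ‖ * (t - s)) / ‖ξ‖ * powIntegral p (z s)) (Set.Icc 0 t) :=
        ContinuousOn.mul (by fun_prop) hNc
      rw [intervalIntegral.integral_of_le ht0, ofReal_integral_eq_lintegral_ofReal
        ((hcont.integrableOn_compact isCompact_Icc).mono_set Set.Ioc_subset_Icc_self)
        ((ae_restrict_mem measurableSet_Ioc).mono fun s hs => hterm ξ s hs.2)]
      refine le_trans (le_of_eq ?_) (lintegral_mono_set (Set.Ioc_subset_Ioc_right
        (by linarith : t / 2 ≤ t)))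
      refine lintegral_congr_ae (hνmem.mono fun s hs => ?_)
      exact (ENNReal.ofReal_mul (hsinh _ _ (norm_nonneg _) (by linarith [hs.2]))).symm
    obtain ⟨h1', h2⟩ := lintegral_le_integral_mul_coneWeight hn hγ0 (by linarith : t + R < a)
      (hw.support t ht) hpos
      (fun ξ hξ => (hDuh ξ).trans (ENNReal.ofReal_le_ofReal (by linarith [hga ξ hξ, hA ξ])))
    rw [lintegral_lintegral_swap] at h2
    swap
    · refine AEMeasurable.mul ?_ (hNmeas.ennreal_ofReal.comp_snd)
      exact (by fun_prop : Measurable fun x : Space n × ℝ =>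
        ENNReal.ofReal (Real.sinh (‖x.1‖ * (t - x.2)) / ‖x.1‖)).aemeasurable
    rw [← ENNReal.ofReal_le_ofReal_iff h1']
    refine le_trans ?_ h2
    rw [← intervalIntegral.integral_const_mul, intervalIntegral.integral_of_le (by linarith),
      ofReal_integral_eq_lintegral_ofReal]
    · refine lintegral_mono_ae (hνmem.mono fun s hs => ?_)
      rw [lintegral_mul_const _ (by fun_prop)]
      have h3 := hker a (s + 2 * R) (by linarith [hs.1]) (by linarith [hs.2])
      rw [show a - (s + 2 * R) = t - s by rw [ha]; ring] at h3
      refine le_trans (le_of_eq ?_) (mul_le_mul_left h3 _)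
      have : 0 ≤ s + 2 * R := by linarith [hs.1]
      rw [← ENNReal.ofReal_mul (by positivity)]
      congr 1
      ring
    · refine (ContinuousOn.integrableOn_compact isCompact_Icc ?_).mono_set
        (Set.Ioc_subset_Icc_self (a := 0) (b := t / 2))
      refine continuousOn_const.mul (ContinuousOn.mul ?_ hNc')
      refine ContinuousOn.rpow_const (by fun_prop) fun s hs => Or.inl ?_
      have := hs.1
      positivity
    · refine hνmem.mono fun s hs => ?_
      have : 0 ≤ s + 2 * R := by linarith [hs.1]
      have := powIntegral_nonneg p (z s)
      have : 0 ≤ a := by linarith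
      positivity

/-! ### Hölder's inequality against the superposed weight -/

theorem VanishesOutside.integral_mul_coneWeight_rpow_le {p a γ ρ : ℝ} (hp1 : 1 < p) (hp2 : p ≤ 2)
    (hγ : 0 < γ) (hρ : ρ < a) {f : L2 n} (hf : VanishesOutside ρ f)
    (h0 : 0 ≤ ∫ x, f x * coneWeight n a γ x) :
    (∫ x, f x * coneWeight n a γ x) ^ p
      ≤ powIntegral p f
        * (∫ x in Metric.closedBall 0 ρ, coneWeight n a γ x ^ (p / (p - 1))) ^ (p - 1) := by
  set B := Metric.closedBall (0 : Space n) ρ with hB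
  set μ := (volume : Measure (Space n)).restrict B with hμ
  have hBfin : volume B ≠ ⊤ := measure_closedBall_lt_top.ne
  have : IsFiniteMeasure μ := ⟨by simpa [hμ] using hBfin.lt_top⟩
  have hmem : ∀ᵐ x ∂μ, ‖x‖ ≤ ρ := by
    filter_upwards [ae_restrict_mem Metric.isClosed_closedBall.measurableSet] with x hx
    simpa [hB] using hx
  have hpq : p.HolderConjugate (p / (p - 1)) := Real.HolderConjugate.conjExponent hp1
  have hp2' : ENNReal.ofReal p ≤ 2 := by simpa using ENNReal.ofReal_le_ofReal hp2
  have hfp : MemLp (fun x => |f x|) (ENNReal.ofReal p) μ := (memLp_restrict hp2' hBfin f).norm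
  have hw0 : ∀ᵐ x ∂μ, 0 ≤ coneWeight n a γ x :=
    hmem.mono fun x hx => coneWeight_nonneg hγ (hx.trans hρ.le)
  have hwb : ∀ᵐ x ∂μ, ‖coneWeight n a γ x‖ ≤ mixConst n γ * (a ^ 2 - ρ ^ 2) ^ (-γ) :=
    hmem.mono fun x hx => by
      rw [Real.norm_of_nonneg (coneWeight_nonneg hγ (hx.trans hρ.le))]
      exact coneWeight_le hγ hρ hx
  have hwp (r : ℝ≥0∞) : MemLp (coneWeight n a γ) r μ :=
    MemLp.of_bound (measurable_coneWeight a γ).aestronglyMeasurable _ hwb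
  have hzero : ∀ᵐ x, x ∉ B → f x = 0 := by
    filter_upwards [hf] with x hx hxB
    exact hx (by simpa [hB] using hxB)
  have h1 : ∫ x, f x * coneWeight n a γ x ≤ ∫ x, |f x| * coneWeight n a γ x ∂μ := by
    rw [← setIntegral_eq_integral_of_ae_compl_eq_zero (s := B)
      (hzero.mono fun x hx hxB => by simp [hx hxB])]
    refine integral_mono_ae ?_ ?_
      (hw0.mono fun x hx => mul_le_mul_of_nonneg_right (le_abs_self _) hx)
    · exact MemLp.integrable_mul (p := 2) (q := 2) ((Lp.memLp f).restrict B) (hwp 2)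
    · exact MemLp.integrable_mul (p := 2) (q := 2) ((Lp.memLp f).restrict B).norm (hwp 2)
  have h2 := integral_mul_le_Lp_mul_Lq_of_nonneg hpq
    (Eventually.of_forall fun x => abs_nonneg (f x)) hw0 hfp (hwp _)
  have h3 : ∫ x, |f x| ^ p ∂μ = powIntegral p f := by
    refine setIntegral_eq_integral_of_ae_compl_eq_zero (hzero.mono fun x hx hxB => ?_)
    rw [hx hxB, abs_zero, Real.zero_rpow (by linarith)]
  rw [h3] at h2
  have hN := powIntegral_nonneg p f
  have hJ : 0 ≤ ∫ x, coneWeight n a γ x ^ (p / (p - 1)) ∂μ :=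
    integral_nonneg_of_ae (hw0.mono fun x hx => Real.rpow_nonneg hx _)
  refine (Real.rpow_le_rpow h0 (h1.trans h2) (by linarith)).trans (le_of_eq ?_)
  have hp0 : p ≠ 0 := by linarith
  have hp10 : p - 1 ≠ 0 := by linarith
  rw [Real.mul_rpow (by positivity) (by positivity), ← Real.rpow_mul hN, ← Real.rpow_mul hJ]
  congr 1
  · rw [one_div_mul_cancel hp0, Real.rpow_one]
  · congr 1
    field_simp

/-- Polar coordinates, with the radial weight `y^(n - 1)` bounded by its value at `ρ`. -/
theorem setIntegral_closedBall_fun_norm_le (hn : 1 ≤ n) {ρ : ℝ} (hρ : 0 ≤ ρ) {F : ℝ → ℝ}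
    (hF : ContinuousOn F (Set.Icc 0 ρ)) (hF0 : ∀ y ∈ Set.Icc 0 ρ, 0 ≤ F y) :
    ∫ x in Metric.closedBall (0 : Space n) ρ, F ‖x‖
      ≤ n * (volume : Measure (Space n)).real (Metric.ball 0 1)
        * (ρ ^ (n - 1) * ∫ y in 0..ρ, F y) := by
  have : Nonempty (Fin n) := ⟨⟨0, hn⟩⟩
  have hnt : Nontrivial (Space n) :=
    Module.nontrivial_of_finrank_pos (R := ℝ) (by rw [finrank_euclideanSpace_fin]; omega)
  have h1 : ∫ x in Metric.closedBall (0 : Space n) ρ, F ‖x‖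
      = ∫ x : Space n, (Set.Iic ρ).indicator F ‖x‖ := by
    rw [← integral_indicator Metric.isClosed_closedBall.measurableSet]
    refine integral_congr_ae (.of_forall fun x => ?_)
    by_cases hx : ‖x‖ ≤ ρ
    · simp [hx]
    · simp [hx]
  rw [h1, integral_fun_norm_addHaar, finrank_euclideanSpace_fin, nsmul_eq_mul, smul_eq_mul,
    ← mul_assoc]
  refine mul_le_mul_of_nonneg_left ?_ (by positivity)
  have h2 : ∫ y in Set.Ioi (0 : ℝ), y ^ (n - 1) • (Set.Iic ρ).indicator F y
      = ∫ y in Set.Ioc 0 ρ, y ^ (n - 1) * F y := by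
    rw [← Set.Ioi_inter_Iic, ← setIntegral_indicator measurableSet_Iic]
    refine integral_congr_ae (.of_forall fun y => ?_)
    by_cases hy : y ≤ ρ
    · simp [hy]
    · simp [hy]
  rw [h2, intervalIntegral.integral_of_le hρ, ← integral_const_mul]
  refine setIntegral_mono_on ?_ ?_ measurableSet_Ioc fun y hy => ?_
  · exact ((ContinuousOn.mul (by fun_prop) hF).integrableOn_compact isCompact_Icc).mono_set
      Set.Ioc_subset_Icc_self
  · exact ((ContinuousOn.mul (by fun_prop) hF).integrableOn_compact isCompact_Icc).mono_set
      Set.Ioc_subset_Icc_self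
  · have := hy.1.le
    exact mul_le_mul_of_nonneg_right (pow_le_pow_left₀ this hy.2 _)
      (hF0 y ⟨this, hy.2⟩)

theorem exists_integral_coneWeight_rpow_le (hn : 1 ≤ n) {γ s : ℝ} (hγ : 0 < γ) (hs : 0 < s) :
    ∃ M : ℝ, 0 < M ∧ ∀ a ρ : ℝ, 0 ≤ ρ → ρ < a →
      ∫ x in Metric.closedBall (0 : Space n) ρ, coneWeight n a γ x ^ s
        ≤ M * (a ^ ((n : ℝ) - 1 - γ * s) * ∫ y in 0..ρ, (a - y) ^ (-(γ * s))) := by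
  set V₁ : ℝ := (volume : Measure (Space n)).real (Metric.ball 0 1) with hV
  have hVpos : 0 < V₁ :=
    ENNReal.toReal_pos (Metric.measure_ball_pos _ _ one_pos).ne' measure_ball_lt_top.ne
  have hK := mixConst_pos (n := n) hγ
  have hn0 : (0 : ℝ) < n := by exact_mod_cast hn
  refine ⟨mixConst n γ ^ s * (n * V₁), by positivity, fun a ρ hρ hρa => ?_⟩
  have ha : 0 < a := by linarith
  set F : ℝ → ℝ := fun y => mixConst n γ ^ s * (a ^ (-(γ * s)) * (a - y) ^ (-(γ * s))) with hFdef
  have hFc : ContinuousOn F (Set.Icc 0 ρ) := by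
    refine continuousOn_const.mul (continuousOn_const.mul ?_)
    exact ContinuousOn.rpow_const (by fun_prop) fun y hy => Or.inl (by linarith [hy.2])
  have hF0 (y : ℝ) (hy : y ∈ Set.Icc 0 ρ) : 0 ≤ F y := by
    have : 0 ≤ a - y := by linarith [hy.2]
    simp only [hFdef]
    positivity
  have hle (x : Space n) (hx : x ∈ Metric.closedBall (0 : Space n) ρ) :
      coneWeight n a γ x ^ s ≤ F ‖x‖ := by
    have hx : ‖x‖ ≤ ρ := by simpa using hx
    have hx0 := norm_nonneg x
    have h1 : 0 < a - ‖x‖ := by linarith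
    have h2 : 0 ≤ a ^ 2 - ‖x‖ ^ 2 := by nlinarith
    rw [coneWeight, Real.mul_rpow hK.le (by positivity), ← Real.rpow_mul h2, neg_mul, hFdef]
    refine mul_le_mul_of_nonneg_left ?_ (by positivity)
    rw [← Real.mul_rpow ha.le h1.le]
    exact Real.rpow_le_rpow_of_nonpos (by positivity) (by nlinarith) (by nlinarith)
  calc ∫ x in Metric.closedBall (0 : Space n) ρ, coneWeight n a γ x ^ s
      ≤ ∫ x in Metric.closedBall (0 : Space n) ρ, F ‖x‖ := by
        refine integral_mono_of_nonneg ?_ ?_ ?_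
        · filter_upwards [ae_restrict_mem Metric.isClosed_closedBall.measurableSet] with x hx
          have hx : ‖x‖ ≤ ρ := by simpa using hx
          exact Real.rpow_nonneg (coneWeight_nonneg hγ (by linarith)) _
        · refine ContinuousOn.integrableOn_compact (isCompact_closedBall _ _) ?_
          exact hFc.comp continuous_norm.continuousOn fun x hx => ⟨norm_nonneg x, by simpa using hx⟩
        · filter_upwards [ae_restrict_mem Metric.isClosed_closedBall.measurableSet] with x hx
          exact hle x hx
    _ ≤ n * V₁ * (ρ ^ (n - 1) * ∫ y in 0..ρ, F y) :=
        setIntegral_closedBall_fun_norm_le hn hρ hFc hF0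
    _ ≤ n * V₁ * (a ^ (n - 1) * ∫ y in 0..ρ, F y) := by
        have : 0 ≤ ∫ y in 0..ρ, F y := intervalIntegral.integral_nonneg hρ hF0
        gcongr
    _ = _ := by
        simp only [hFdef]
        rw [intervalIntegral.integral_const_mul, intervalIntegral.integral_const_mul]
        have e : a ^ ((n : ℝ) - 1 - γ * s) = a ^ (n - 1) * a ^ (-(γ * s)) := by
          rw [← Real.rpow_natCast a (n - 1), ← Real.rpow_add ha, Nat.cast_sub hn]
          congr 1
          push_cast; ring
        rw [e]
        ring

/-- Hölder's inequality against `coneWeight`, with the exponent chosen so that its dual power is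
`(a² - ‖x‖²)^(-κ)`. -/
theorem exists_integral_mul_coneWeight_rpow_le (hn : 1 ≤ n) {p κ : ℝ} (hp1 : 1 < p) (hp2 : p ≤ 2)
    (hκ : 0 < κ) :
    ∃ M : ℝ, 0 < M ∧ ∀ (a ρ : ℝ) (f : L2 n), 0 ≤ ρ → ρ < a → VanishesOutside ρ f →
      0 ≤ ∫ x, f x * coneWeight n a (κ * (1 - 1 / p)) x →
      (∫ x, f x * coneWeight n a (κ * (1 - 1 / p)) x) ^ p
        ≤ powIntegral p f
          * (M * (a ^ ((n : ℝ) - 1 - κ) * ∫ y in 0..ρ, (a - y) ^ (-κ))) ^ (p - 1) := by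
  have hp0 : 0 < p := by linarith
  have hp10 : 0 < p - 1 := by linarith
  have h1 : 0 < 1 - 1 / p := by rw [sub_pos, div_lt_one hp0]; exact hp1
  have hγ : 0 < κ * (1 - 1 / p) := by positivity
  obtain ⟨M, hM, hle⟩ := exists_integral_coneWeight_rpow_le hn hγ (s := p / (p - 1)) (by positivity)
  have he : κ * (1 - 1 / p) * (p / (p - 1)) = κ := by field_simp
  rw [he] at hle
  refine ⟨M, hM, fun a ρ f hρ hρa hf h0 => ?_⟩
  refine (hf.integral_mul_coneWeight_rpow_le hp1 hp2 hγ hρa h0).trans ?_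
  refine mul_le_mul_of_nonneg_left ?_ (powIntegral_nonneg p f)
  refine Real.rpow_le_rpow ?_ (hle a ρ hρ hρa) (by linarith)
  refine setIntegral_nonneg Metric.isClosed_closedBall.measurableSet fun x hx => ?_
  have hx : ‖x‖ ≤ ρ := by simpa using hx
  exact Real.rpow_nonneg (coneWeight_nonneg hγ (by linarith)) _

theorem integral_sub_rpow_neg_one {a R : ℝ} (hR : 0 < R) (ha : R ≤ a) :
    ∫ y in 0..a - R, (a - y) ^ (-1 : ℝ) = Real.log (a / R) := by
  have h := intervalIntegral.integral_comp_sub_left (fun x : ℝ => x ^ (-1 : ℝ)) a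
    (a := 0) (b := a - R)
  rw [h]
  simp only [Real.rpow_neg_one, sub_sub_cancel, sub_zero]
  exact integral_inv_of_pos hR (by linarith)

theorem integral_sub_rpow_neg_two_le {a R : ℝ} (hR : 0 < R) (ha : R ≤ a) :
    ∫ y in 0..a - R, (a - y) ^ (-2 : ℝ) ≤ 1 / R := by
  have h := intervalIntegral.integral_comp_sub_left (fun x : ℝ => x ^ (-2 : ℝ)) a
    (a := 0) (b := a - R)
  rw [h]
  simp only [sub_sub_cancel, sub_zero]
  rw [integral_rpow (Or.inr ⟨by norm_num, ?_⟩)]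
  · norm_num
    rw [Real.rpow_neg_one, Real.rpow_neg_one]
    have : 0 < a⁻¹ := inv_pos.2 (by linarith)
    linarith
  · rw [Set.uIcc_of_le ha]
    exact fun h => by linarith [h.1]

/-! ### The critical exponent -/

/-- For `p = q` the criticality condition says that `p` is Strauss' exponent. -/
theorem mul_eq_of_criticalF {p : ℝ} (hp : 1 < p) (hF : criticalF p p n = 0) :
    ((n : ℝ) - 1) * (p * (p - 1)) = 2 * (p + 1) := by
  unfold criticalF at hF
  rw [max_self, ← sq] at hF
  have h1 : p ^ 2 - 1 ≠ 0 := by nlinarith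
  have h2 : p ≠ 0 := by linarith
  field_simp at hF
  have h3 : (p + 1) * (((n : ℝ) - 1) * (p * (p - 1)) - 2 * (p + 1)) = 0 := by
    linear_combination -hF
  rcases mul_eq_zero.1 h3 with h | h <;> linarith

theorem le_two_of_criticalF {p : ℝ} (hn : 4 ≤ n) (hp : 1 < p) (hF : criticalF p p n = 0) :
    p ≤ 2 := by
  have h := mul_eq_of_criticalF hp hF
  have hn' : (4 : ℝ) ≤ n := by exact_mod_cast hn
  have : (3 : ℝ) * (p * (p - 1)) ≤ 2 * (p + 1) := by
    rw [← h]
    have : 0 < p * (p - 1) := mul_pos (by linarith) (by linarith)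
    nlinarith
  nlinarith

/-! ### Lower bounds for the source terms -/

/-- The growth exponent `n - 1 - (n - 1) p / 2` of the source terms. -/
noncomputable def growthExp (n : ℕ) (p : ℝ) : ℝ := (n : ℝ) - 1 - ((n : ℝ) - 1) * p / 2

theorem growthExp_nonneg (hn : 1 ≤ n) {p : ℝ} (hp2 : p ≤ 2) : 0 ≤ growthExp n p := by
  have : (1 : ℝ) ≤ n := by exact_mod_cast hn
  unfold growthExp
  nlinarith

/-- A weak solution `w` with nonnegative data, driven by a continuous source `|z|^p` with support in
the forward light cone of the data. -/
structure IsDrivenWave (p R : ℝ) (T : EReal) (w₀ w₁ : L2 n) (z w wt : ℝ → L2 n) : Prop where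
  wave : IsWeakWave p R T w₀ w₁ z w wt
  pos_nonneg : 0 ≤ w₀
  vel_nonneg : 0 ≤ w₁
  continuous_source : ContinuousOn z (timeInterval T)
  support_source : ∀ t ∈ timeInterval T, VanishesOutside (t + R) (z t)

/-- The bound from the source term: the dual weight `(a² - ‖x‖²)^(-1)` is critically
non-integrable at the cone, which costs the power `p - 1` of a logarithm. -/
theorem exists_source_bound (hn : 4 ≤ n) {p : ℝ} (hp : 1 < p) (hF : criticalF p p n = 0) :
    ∃ c : ℝ, 0 < c ∧ ∀ (R : ℝ) (T : EReal) (w₀ w₁ : L2 n) (z w wt : ℝ → L2 n), 0 < R →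
      IsDrivenWave p R T w₀ w₁ z w wt → ∀ t ∈ timeInterval T, R ≤ t →
      c * (t + 2 * R) ^ growthExp n p *
          (∫ s in 0..t / 2, (s + 2 * R) ^ (-(growthExp n p + 1)) * powIntegral p (z s)) ^ p
        ≤ powIntegral p (w t) * Real.log ((t + 2 * R) / R) ^ (p - 1) := by
  have hp2 := le_two_of_criticalF hn hp hF
  have hcrit := mul_eq_of_criticalF hp hF
  have hp0 : 0 < p := by linarith
  have hn' : (4 : ℝ) ≤ n := by exact_mod_cast hn
  have h1p : 0 < 1 - 1 / p := by rw [sub_pos, div_lt_one hp0]; exact hp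
  have h1p' : 1 - 1 / p ≤ 1 := by linarith [one_div_pos.2 hp0]
  obtain ⟨c, hc, hlow⟩ := exists_integral_mul_coneWeight_ge (n := n) (by omega) hp hp2
    (γ := 1 * (1 - 1 / p)) (by linarith) (by linarith)
  obtain ⟨M, hM, hup⟩ := exists_integral_mul_coneWeight_rpow_le (n := n) (by omega) hp hp2 one_pos
  refine ⟨c ^ p / M ^ (p - 1), by positivity, fun R T w₀ w₁ z w wt hR hw t ht htR => ?_⟩
  have h1 := (hlow R T w₀ w₁ z w wt hR hw.wave hw.pos_nonneg hw.vel_nonneg hw.continuous_source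
    hw.support_source t ht).2 htR
  have hq : -(((n : ℝ) - 3) / 2 + 1 * (1 - 1 / p)) = -(growthExp n p + 1) := by
    unfold growthExp
    field_simp
    linear_combination -hcrit
  rw [hq] at h1
  set a := t + 2 * R with ha
  have ha0 : 0 < a := by linarith
  set J := ∫ s in 0..t / 2, (s + 2 * R) ^ (-(growthExp n p + 1)) * powIntegral p (z s) with hJ
  have hJ0 : 0 ≤ J := intervalIntegral.integral_nonneg (by linarith) fun s hs =>
    mul_nonneg (Real.rpow_nonneg (by linarith [hs.1]) _) (powIntegral_nonneg _ _)
  have hY0 : 0 ≤ c * a ^ (((n : ℝ) - 1) / 2 - 1 * (1 - 1 / p)) * J := by positivity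
  have h2 := hup a (t + R) (w t) (by linarith) (by linarith) (hw.wave.support t ht) (hY0.trans h1)
  rw [show t + R = a - R by rw [ha]; ring, integral_sub_rpow_neg_one hR (by linarith)] at h2
  have h3 := (Real.rpow_le_rpow hY0 h1 hp0.le).trans h2
  have hlog : 0 ≤ Real.log (a / R) := Real.log_nonneg (by rw [le_div_iff₀ hR]; linarith)
  rw [Real.mul_rpow (by positivity) hJ0, Real.mul_rpow hc.le (by positivity),
    Real.mul_rpow hM.le (by positivity), Real.mul_rpow (by positivity) hlog,
    ← Real.rpow_mul ha0.le, ← Real.rpow_mul ha0.le] at h3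
  have he : a ^ ((((n : ℝ) - 1) / 2 - 1 * (1 - 1 / p)) * p)
      = a ^ growthExp n p * a ^ (((n : ℝ) - 1 - 1) * (p - 1)) := by
    rw [← Real.rpow_add ha0]
    congr 1
    unfold growthExp
    field_simp
    ring
  rw [he] at h3
  have hpos1 : 0 < a ^ (((n : ℝ) - 1 - 1) * (p - 1)) := by positivity
  have hpos2 : 0 < M ^ (p - 1) := by positivity
  rw [div_mul_eq_mul_div, div_mul_eq_mul_div, div_le_iff₀ hpos2]
  refine le_of_mul_le_mul_right ?_ hpos1
  linarith

/-- The bound from the initial velocity. -/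
theorem exists_initial_bound (hn : 4 ≤ n) {p : ℝ} (hp : 1 < p) (hp2 : p ≤ 2) :
    ∃ c e : ℝ, 0 < c ∧ ∀ (R : ℝ) (T : EReal) (w₀ w₁ : L2 n) (z w wt : ℝ → L2 n), 0 < R →
      IsDrivenWave p R T w₀ w₁ z w wt → ∀ t ∈ timeInterval T, R / 2 ≤ t →
      c * R ^ (p - 1) * ((2 * R) ^ e * ∫ x, w₁ x) ^ p * (t + 2 * R) ^ growthExp n p
        ≤ powIntegral p (w t) := by
  have hp0 : 0 < p := by linarith
  have hn' : (4 : ℝ) ≤ n := by exact_mod_cast hn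
  have h1p : 0 < 1 - 1 / p := by rw [sub_pos, div_lt_one hp0]; exact hp
  have h1p' : 1 - 1 / p ≤ 1 := by linarith [one_div_pos.2 hp0]
  obtain ⟨c, hc, hlow⟩ := exists_integral_mul_coneWeight_ge (n := n) (by omega) hp hp2
    (γ := 2 * (1 - 1 / p)) (by linarith) (by linarith)
  obtain ⟨M, hM, hup⟩ := exists_integral_mul_coneWeight_rpow_le (n := n) (by omega) hp hp2 two_pos
  refine ⟨c ^ p / M ^ (p - 1), -(((n : ℝ) - 3) / 2 + 2 * (1 - 1 / p)), by positivity,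
    fun R T w₀ w₁ z w wt hR hw t ht htR => ?_⟩
  have h1 := (hlow R T w₀ w₁ z w wt hR hw.wave hw.pos_nonneg hw.vel_nonneg hw.continuous_source
    hw.support_source t ht).1 htR
  set a := t + 2 * R with ha
  have ha0 : 0 < a := by linarith
  set J := (2 * R) ^ (-(((n : ℝ) - 3) / 2 + 2 * (1 - 1 / p))) * ∫ x, w₁ x with hJ
  have hJ0 : 0 ≤ J :=
    mul_nonneg (by positivity) (integral_nonneg_of_ae (L2_ae_nonneg hw.vel_nonneg))
  clear_value J
  have hY0 : 0 ≤ c * a ^ (((n : ℝ) - 1) / 2 - 2 * (1 - 1 / p)) * J := by positivity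
  have h2 := hup a (t + R) (w t) (by linarith) (by linarith) (hw.wave.support t ht) (hY0.trans h1)
  rw [show t + R = a - R by rw [ha]; ring] at h2
  have hI0 : 0 ≤ ∫ y in 0..a - R, (a - y) ^ (-2 : ℝ) :=
    intervalIntegral.integral_nonneg (by linarith) fun y hy =>
      Real.rpow_nonneg (by linarith [hy.2]) _
  have hN := powIntegral_nonneg p (w t)
  have h2' : powIntegral p (w t)
        * (M * (a ^ ((n : ℝ) - 1 - 2) * ∫ y in 0..a - R, (a - y) ^ (-2 : ℝ))) ^ (p - 1)
      ≤ powIntegral p (w t) * (M * (a ^ ((n : ℝ) - 1 - 2) * R⁻¹)) ^ (p - 1) := by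
    have := integral_sub_rpow_neg_two_le hR (by linarith : R ≤ a)
    rw [one_div] at this
    have hp1 : 0 ≤ p - 1 := by linarith
    gcongr
  have h3 := (Real.rpow_le_rpow hY0 h1 hp0.le).trans (h2.trans h2')
  rw [Real.mul_rpow (by positivity) hJ0, Real.mul_rpow hc.le (by positivity),
    Real.mul_rpow hM.le (by positivity), Real.mul_rpow (by positivity) (by positivity),
    Real.inv_rpow hR.le, ← Real.rpow_mul ha0.le, ← Real.rpow_mul ha0.le] at h3
  have he : a ^ ((((n : ℝ) - 1) / 2 - 2 * (1 - 1 / p)) * p)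
      = a ^ growthExp n p * a ^ (((n : ℝ) - 1 - 2) * (p - 1)) := by
    rw [← Real.rpow_add ha0]
    congr 1
    unfold growthExp
    field_simp
    ring
  rw [he] at h3
  have hpos1 : 0 < a ^ (((n : ℝ) - 1 - 2) * (p - 1)) := by positivity
  have hpos2 : 0 < M ^ (p - 1) := by positivity
  have hpos3 : 0 < R ^ (p - 1) := by positivity
  rw [div_mul_eq_mul_div, div_mul_eq_mul_div, div_mul_eq_mul_div, div_le_iff₀ hpos2]
  have h4 := mul_le_mul_of_nonneg_right h3 hpos3.le
  field_simp at h4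
  linarith

/-! ### One step of the iteration -/

/-- `∫ log^k d log = log^(k+1) / (k+1)`. -/
theorem integral_log_rpow_div {m β k x : ℝ} (hβm : 0 < β + m) (hk : 0 ≤ k) (hβx : β ≤ x) :
    IntervalIntegrable (fun s => Real.log ((s + m) / (β + m)) ^ k * (s + m)⁻¹) volume β x ∧
    ∫ s in β..x, Real.log ((s + m) / (β + m)) ^ k * (s + m)⁻¹
      = Real.log ((x + m) / (β + m)) ^ (k + 1) / (k + 1) := by
  have hk1 : k + 1 ≠ 0 := by positivity
  have hderiv (s : ℝ) (hs : s ∈ Set.uIcc β x) :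
      HasDerivAt (fun s => Real.log ((s + m) / (β + m)) ^ (k + 1) / (k + 1))
        (Real.log ((s + m) / (β + m)) ^ k * (s + m)⁻¹) s := by
    rw [Set.uIcc_of_le hβx] at hs
    have hsm : 0 < s + m := by linarith [hs.1]
    have h1 : HasDerivAt (fun s => (s + m) / (β + m)) (1 / (β + m)) s :=
      ((hasDerivAt_id s).add_const m).div_const _
    have h2 := ((h1.log (by positivity)).rpow_const (p := k + 1) (Or.inr (by linarith))).div_const
      (k + 1)
    refine h2.congr_deriv ?_
    rw [add_sub_cancel_right]
    field_simp
  have hcont : ContinuousOn (fun s => Real.log ((s + m) / (β + m)) ^ k * (s + m)⁻¹)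
      (Set.uIcc β x) := by
    rw [Set.uIcc_of_le hβx]
    have hne (s : ℝ) (hs : s ∈ Set.Icc β x) : s + m ≠ 0 := by linarith [hs.1]
    refine ContinuousOn.mul (ContinuousOn.rpow_const (ContinuousOn.log (by fun_prop) ?_)
      fun _ _ => Or.inr hk) (ContinuousOn.inv₀ (by fun_prop) hne)
    exact fun s hs => div_ne_zero (hne s hs) hβm.ne'
  refine ⟨hcont.intervalIntegrable, ?_⟩
  rw [intervalIntegral.integral_eq_sub_of_hasDerivAt hderiv hcont.intervalIntegrable,
    div_self hβm.ne', Real.log_one, Real.zero_rpow hk1, zero_div, sub_zero]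

/-- The factor lost in one step of the iteration: `(k + 1)^(-p)` from integrating `log^k`, the
second factor from replacing `s - b R` by `s + 2 R`, and the third from comparing logarithms. -/
noncomputable def stepLoss (α p b m k : ℝ) : ℝ :=
  (k + 1) ^ (-p) * (2 * b + 5) ^ (-(α * p)) * ((2 * b + 3) * (2 * b + 1 + 2 * m)) ^ (-(p - 1))

theorem stepLoss_pos {α p b m k : ℝ} (hb : 1 / 2 ≤ b) (hm : 2 ≤ m) (hk : 0 ≤ k) :
    0 < stepLoss α p b m k := by
  unfold stepLoss; positivity

/-- The full logarithm `log (t / R + 2)` is controlled by the logarithm produced by the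
iteration, by Bernoulli's inequality. -/
theorem log_le_mul_log {R b m t : ℝ} (hR : 0 < R) (hb : 1 / 2 ≤ b) (hm : 2 ≤ m)
    (ht : (2 * b + 2) * R ≤ t) :
    0 < Real.log ((t / 2 + m * R) / ((b + 1 / 2 + m) * R)) ∧
    Real.log ((t + 2 * R) / R) ≤ (2 * b + 3) * (2 * b + 1 + 2 * m)
      * Real.log ((t / 2 + m * R) / ((b + 1 / 2 + m) * R)) := by
  obtain ⟨τ, rfl⟩ : ∃ τ, t = τ * R := ⟨t / R, by field_simp⟩
  have hτ : 2 * b + 2 ≤ τ := le_of_mul_le_mul_right ht hR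
  set y : ℝ := (τ - (2 * b + 1)) / (2 * b + 1 + 2 * m) with hy
  have hy0 : 0 < y := div_pos (by linarith) (by linarith)
  have e1 : (τ * R / 2 + m * R) / ((b + 1 / 2 + m) * R) = 1 + y := by
    rw [hy]; field_simp; ring
  have e2 : (τ * R + 2 * R) / R = τ + 2 := by field_simp
  rw [e1, e2]
  refine ⟨Real.log_pos (by linarith), ?_⟩
  set K : ℝ := (2 * b + 3) * (2 * b + 1 + 2 * m) with hK
  have hK1 : 1 ≤ K := by rw [hK]; nlinarith
  rw [← Real.log_rpow (by linarith)]
  refine Real.log_le_log (by linarith) (le_trans ?_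
    (one_add_mul_self_le_rpow_one_add (by linarith) hK1))
  have : K * y = (2 * b + 3) * (τ - (2 * b + 1)) := by
    rw [hK, hy]; field_simp
  rw [this]
  nlinarith

/-- One step of the iteration: a lower bound with `log^k` for the source gives one with
`log^(k p + 1)` for the solution. -/
theorem exists_iteration_step (hn : 4 ≤ n) {p : ℝ} (hp : 1 < p) (hF : criticalF p p n = 0) :
    ∃ c : ℝ, 0 < c ∧ ∀ (R : ℝ) (T : EReal) (w₀ w₁ : L2 n) (z w wt : ℝ → L2 n), 0 < R →
      IsDrivenWave p R T w₀ w₁ z w wt → ∀ A b m k : ℝ, 0 ≤ A → 1 / 2 ≤ b → 2 ≤ m → 0 ≤ k →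
      (∀ s ∈ timeInterval T, b * R ≤ s →
        A * (s - b * R) ^ growthExp n p * Real.log ((s + m * R) / ((b + m) * R)) ^ k
          ≤ powIntegral p (z s)) →
      ∀ t ∈ timeInterval T, (2 * b + 2) * R ≤ t →
        c * stepLoss (growthExp n p) p b m k * A ^ p * (t - (2 * b + 2) * R) ^ growthExp n p
          * Real.log ((t / 2 + m * R) / ((b + 1 / 2 + m) * R)) ^ (k * p + 1)
          ≤ powIntegral p (w t) := by
  have hp2 := le_two_of_criticalF hn hp hF
  obtain ⟨c, hc, hsrc⟩ := exists_source_bound hn hp hF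
  refine ⟨c, hc, fun R T w₀ w₁ z w wt hR hw A b m k hA hb hm hk hlow t ht htb => ?_⟩
  set α := growthExp n p with hα
  have hα0 : 0 ≤ α := growthExp_nonneg (by omega) hp2
  have hp0 : 0 < p := by linarith
  obtain ⟨hΛ, hlog⟩ := log_le_mul_log hR hb hm htb
  set Λ := Real.log ((t / 2 + m * R) / ((b + 1 / 2 + m) * R)) with hΛdef
  set K : ℝ := (2 * b + 3) * (2 * b + 1 + 2 * m) with hK
  have hK0 : 0 < K := by positivity
  have hbR : 0 < b * R := by positivity
  have htR : R ≤ t := by nlinarith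
  have h1 := hsrc R T w₀ w₁ z w wt hR hw t ht htR
  have hIcc : Set.Icc 0 t ⊆ timeInterval T := fun s hs => timeInterval_mono hs.1 hs.2 ht
  set J := ∫ s in 0..t / 2, (s + 2 * R) ^ (-(α + 1)) * powIntegral p (z s) with hJ
  -- only the times between `(b + 1/2) R` and `t / 2` are used
  have hJge : A * (2 * b + 5) ^ (-α) * (Λ ^ (k + 1) / (k + 1)) ≤ J := by
    set β : ℝ := (b + 1 / 2) * R with hβ
    have hβ0 : 0 < β := by positivity
    have hβt : β ≤ t / 2 := by rw [hβ]; nlinarith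
    have hβm : 0 < β + m * R := by positivity
    obtain ⟨hint, hval⟩ := integral_log_rpow_div hβm hk hβt
    have hβm' : β + m * R = (b + 1 / 2 + m) * R := by rw [hβ]; ring
    rw [hβm'] at hint hval
    rw [← hΛdef] at hval
    have hg : ContinuousOn (fun s => (s + 2 * R) ^ (-(α + 1)) * powIntegral p (z s))
        (Set.Icc 0 (t / 2)) := by
      refine ContinuousOn.mul (ContinuousOn.rpow_const (by fun_prop) fun s hs => Or.inl ?_)
        ((continuousOn_powIntegral hp.le hp2 hw.continuous_source hw.support_source).mono ?_)
      · have := hs.1; positivity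
      · exact (Set.Icc_subset_Icc_right (by linarith)).trans hIcc
    have hgi : IntervalIntegrable (fun s => (s + 2 * R) ^ (-(α + 1)) * powIntegral p (z s))
        volume 0 (t / 2) := by
      refine ContinuousOn.intervalIntegrable ?_
      rwa [Set.uIcc_of_le (by linarith)]
    calc A * (2 * b + 5) ^ (-α) * (Λ ^ (k + 1) / (k + 1))
        = ∫ s in β..t / 2, A * (2 * b + 5) ^ (-α)
            * (Real.log ((s + m * R) / ((b + 1 / 2 + m) * R)) ^ k * (s + m * R)⁻¹) := by
          rw [intervalIntegral.integral_const_mul, hval]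
      _ ≤ ∫ s in β..t / 2, (s + 2 * R) ^ (-(α + 1)) * powIntegral p (z s) := by
          refine intervalIntegral.integral_mono_on hβt (hint.const_mul _)
            (hgi.mono_set ?_) fun s hs => ?_
          · rw [Set.uIcc_of_le hβt, Set.uIcc_of_le (by linarith)]
            exact Set.Icc_subset_Icc_left hβ0.le
          · have hs1 : (b + 1 / 2) * R ≤ s := hs.1
            have hs0 : 0 < s := hβ0.trans_le hs.1
            have hsm : 0 < s + m * R := by positivity
            have h2 := hlow s (hIcc ⟨hs0.le, by linarith [hs.2]⟩) (by linarith)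
            have hl0 : 0 ≤ Real.log ((s + m * R) / ((b + 1 / 2 + m) * R)) := by
              refine Real.log_nonneg ?_
              rw [le_div_iff₀ (by positivity)]
              linarith
            have hll : Real.log ((s + m * R) / ((b + 1 / 2 + m) * R))
                ≤ Real.log ((s + m * R) / ((b + m) * R)) := by
              refine Real.log_le_log (by positivity) ?_
              have : (b + m) * R ≤ (b + 1 / 2 + m) * R := by nlinarith
              gcongr
            have hsb : (s + 2 * R) * (2 * b + 5)⁻¹ ≤ s - b * R := by
              rw [← div_eq_mul_inv, div_le_iff₀ (by positivity)]
              nlinarith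
            have e1 : (s + 2 * R) ^ (-(α + 1)) * ((s + 2 * R) * (2 * b + 5)⁻¹) ^ α
                = (2 * b + 5) ^ (-α) * (s + 2 * R)⁻¹ := by
              rw [Real.mul_rpow (by positivity) (by positivity), neg_add,
                Real.rpow_add (by positivity), Real.rpow_neg (by positivity) α,
                Real.rpow_neg_one, Real.rpow_neg (by positivity) α, Real.inv_rpow (by positivity)]
              have : (s + 2 * R) ^ α ≠ 0 := by positivity
              field_simp
            calc A * (2 * b + 5) ^ (-α)
                  * (Real.log ((s + m * R) / ((b + 1 / 2 + m) * R)) ^ k * (s + m * R)⁻¹)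
                ≤ A * (2 * b + 5) ^ (-α)
                  * (Real.log ((s + m * R) / ((b + m) * R)) ^ k * (s + 2 * R)⁻¹) := by
                  have := hl0.trans hll
                  gcongr
              _ = (s + 2 * R) ^ (-(α + 1)) * (A * ((s + 2 * R) * (2 * b + 5)⁻¹) ^ α
                  * Real.log ((s + m * R) / ((b + m) * R)) ^ k) := by
                  linear_combination (-A * Real.log ((s + m * R) / ((b + m) * R)) ^ k) * e1
              _ ≤ (s + 2 * R) ^ (-(α + 1)) * (A * (s - b * R) ^ α
                  * Real.log ((s + m * R) / ((b + m) * R)) ^ k) := by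
                  have := hl0.trans hll
                  gcongr
              _ ≤ _ := by gcongr
      _ ≤ J := by
          rw [hJ, ← intervalIntegral.integral_add_adjacent_intervals
            (hgi.mono_set (Set.uIcc_subset_uIcc_left ?_))
            (hgi.mono_set (Set.uIcc_subset_uIcc_right ?_)), le_add_iff_nonneg_left]
          · refine intervalIntegral.integral_nonneg hβ0.le fun s hs => ?_
            have := hs.1
            have := powIntegral_nonneg p (z s)
            positivity
          all_goals
            rw [Set.uIcc_of_le (by linarith)]
            exact ⟨hβ0.le, hβt⟩
  have hN := powIntegral_nonneg p (w t)
  have hlog0 : 0 ≤ Real.log ((t + 2 * R) / R) :=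
    Real.log_nonneg (by rw [le_div_iff₀ hR]; linarith)
  have hp10 : 0 ≤ p - 1 := by linarith
  have h3 : c * (t - (2 * b + 2) * R) ^ α * (A * (2 * b + 5) ^ (-α) * (Λ ^ (k + 1) / (k + 1))) ^ p
      ≤ powIntegral p (w t) * (K * Λ) ^ (p - 1) := by
    have h0 : 0 ≤ t - (2 * b + 2) * R := by linarith
    have ha0 : 0 < t + 2 * R := by linarith
    calc _ ≤ c * (t + 2 * R) ^ α * J ^ p := by
          gcongr
          nlinarith
      _ ≤ _ := h1
      _ ≤ _ := by gcongr
  have e2 : (A * (2 * b + 5) ^ (-α) * (Λ ^ (k + 1) / (k + 1))) ^ p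
      = A ^ p * (2 * b + 5) ^ (-(α * p)) * (Λ ^ (k * p + 1) * Λ ^ (p - 1) * (k + 1) ^ (-p)) := by
    rw [Real.mul_rpow (by positivity) (by positivity), Real.mul_rpow hA (by positivity),
      Real.div_rpow (by positivity) (by positivity), ← Real.rpow_mul (by positivity),
      ← Real.rpow_mul hΛ.le, ← Real.rpow_add hΛ, Real.rpow_neg (by positivity : 0 ≤ k + 1) p,
      neg_mul, div_eq_mul_inv]
    congr 4
    ring
  rw [e2, Real.mul_rpow hK0.le hΛ.le] at h3
  have hpos : 0 < K ^ (p - 1) * Λ ^ (p - 1) := by positivity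
  refine le_of_mul_le_mul_right ?_ hpos
  refine le_trans (le_of_eq ?_) h3
  rw [stepLoss, ← hK, Real.rpow_neg hK0.le]
  have : K ^ (p - 1) ≠ 0 := by positivity
  field_simp

/-! ### Lower bounds with logarithms -/

/-- The logarithm in the `b`-th lower bound; it vanishes at `t = b R`. -/
noncomputable def logFactor (b R t : ℝ) : ℝ :=
  Real.log ((t + (b ^ 2 - 6) * R) / ((b - 2) * (b + 3) * R))

/-- The lower bound `A (t - b R)^(n - 1 - (n - 1) p / 2) log^k` for the source `∫ |z(t)|^p`, from
time `b R` on. -/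
def GrowthBound (p R : ℝ) (T : EReal) (A b k : ℝ) (z : ℝ → L2 n) : Prop :=
  ∀ t ∈ timeInterval T, b * R ≤ t →
    A * (t - b * R) ^ growthExp n p * logFactor b R t ^ k ≤ powIntegral p (z t)

theorem logFactor_nonneg {b R t : ℝ} (hR : 0 < R) (hb : 3 ≤ b) (ht : b * R ≤ t) :
    0 ≤ logFactor b R t := by
  have : 0 < (b - 2) * (b + 3) := by nlinarith
  refine Real.log_nonneg ?_
  rw [le_div_iff₀ (by positivity)]
  nlinarith

theorem GrowthBound.mono {p R A A' b k : ℝ} {T : EReal} {z : ℝ → L2 n} (hR : 0 < R) (hb : 3 ≤ b)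
    (h : GrowthBound p R T A b k z) (hA : A' ≤ A) : GrowthBound p R T A' b k z := by
  intro t ht htb
  refine le_trans ?_ (h t ht htb)
  have := logFactor_nonneg hR hb htb
  have : 0 ≤ t - b * R := by linarith
  gcongr

/-- Passing from `b` to `2 b + 2` absorbs the restriction to times between `(b + 1/2) R` and
`t / 2`. -/
theorem logFactor_next_le {b R t : ℝ} (hR : 0 < R) (hb : 3 ≤ b) (ht : (2 * b + 2) * R ≤ t) :
    logFactor (2 * b + 2) R t
      ≤ Real.log ((t / 2 + (b ^ 2 - 6) * R) / ((b + 1 / 2 + (b ^ 2 - 6)) * R)) := by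
  obtain ⟨τ, rfl⟩ : ∃ τ, t = τ * R := ⟨t / R, by field_simp⟩
  have hτ : 2 * b + 2 ≤ τ := le_of_mul_le_mul_right ht hR
  have h1 : 0 < (2 * b) * (2 * b + 5) := by nlinarith
  have h2 : 0 < 2 * b ^ 2 + 2 * b - 11 := by nlinarith
  have e1 : (τ * R + ((2 * b + 2) ^ 2 - 6) * R) / ((2 * b + 2 - 2) * (2 * b + 2 + 3) * R)
      = 1 + (τ - (2 * b + 2)) / ((2 * b) * (2 * b + 5)) := by
    rw [show 2 * b + 2 - 2 = 2 * b by ring, show 2 * b + 2 + 3 = 2 * b + 5 by ring]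
    field_simp; ring
  have e2 : (τ * R / 2 + (b ^ 2 - 6) * R) / ((b + 1 / 2 + (b ^ 2 - 6)) * R)
      = 1 + (τ - (2 * b + 1)) / (2 * b ^ 2 + 2 * b - 11) := by
    have : b + 1 / 2 + (b ^ 2 - 6) = (2 * b ^ 2 + 2 * b - 11) / 2 := by ring
    rw [this, one_add_div h2.ne', div_eq_div_iff (by positivity) h2.ne']
    ring
  rw [logFactor, e1, e2]
  have h3 : 0 ≤ (τ - (2 * b + 2)) / ((2 * b) * (2 * b + 5)) := div_nonneg (by linarith) h1.le
  refine Real.log_le_log (by linarith) ?_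
  have h4 : (τ - (2 * b + 2)) / ((2 * b) * (2 * b + 5))
      ≤ (τ - (2 * b + 1)) / (2 * b ^ 2 + 2 * b - 11) :=
    div_le_div₀ (by linarith) (by linarith) h2 (by nlinarith)
  linarith

/-- The iteration step and its first instance, in terms of `GrowthBound`. -/
theorem exists_growthBound_step (hn : 4 ≤ n) {p : ℝ} (hp : 1 < p) (hF : criticalF p p n = 0) :
    ∃ c : ℝ, 0 < c ∧ ∀ (R : ℝ) (T : EReal) (w₀ w₁ : L2 n) (z w wt : ℝ → L2 n), 0 < R →
      IsDrivenWave p R T w₀ w₁ z w wt → ∀ A : ℝ, 0 ≤ A →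
      ((∀ s ∈ timeInterval T, R / 2 ≤ s → A * (s + 2 * R) ^ growthExp n p ≤ powIntegral p (z s)) →
        GrowthBound p R T (c * stepLoss (growthExp n p) p (1 / 2) 2 0 * A ^ p) 3 1 w) ∧
      ∀ b k : ℝ, 3 ≤ b → 0 ≤ k → GrowthBound p R T A b k z →
        GrowthBound p R T (c * stepLoss (growthExp n p) p b (b ^ 2 - 6) k * A ^ p) (2 * b + 2)
          (k * p + 1) w := by
  obtain ⟨c, hc, hstep⟩ := exists_iteration_step hn hp hF
  have hα := growthExp_nonneg (n := n) (by omega) (le_two_of_criticalF hn hp hF)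
  refine ⟨c, hc, fun R T w₀ w₁ z w wt hR hw A hA => ⟨fun hlow t ht htb => ?_,
    fun b k hb hk hlow t ht htb => ?_⟩⟩
  · have h := hstep R T w₀ w₁ z w wt hR hw A (1 / 2) 2 0 hA le_rfl le_rfl le_rfl
      (fun s hs hsb => ?_) t ht (by linarith)
    · have e : (t / 2 + 2 * R) / ((1 / 2 + 1 / 2 + 2) * R)
          = (t + (3 ^ 2 - 6) * R) / ((3 - 2) * (3 + 3) * R) + R / (6 * R) := by
        field_simp; ring
      have e' : (t / 2 + 2 * R) / ((1 / 2 + 1 / 2 + 2) * R)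
          ≥ (t + (3 ^ 2 - 6) * R) / ((3 - 2) * (3 + 3) * R) := by
        rw [e]; have : 0 ≤ R / (6 * R) := by positivity
        linarith
      have hlog : logFactor 3 R t ≤ Real.log ((t / 2 + 2 * R) / ((1 / 2 + 1 / 2 + 2) * R)) := by
        refine Real.log_le_log (div_pos ?_ (by linarith)) e'
        linarith
      have hpos := logFactor_nonneg hR le_rfl htb
      have hs := (stepLoss_pos (α := growthExp n p) (p := p) le_rfl le_rfl (le_refl (0 : ℝ))).le
      have h0 : 0 ≤ t - 3 * R := by linarith
      refine le_trans ?_ h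
      rw [show (2 * (1 / 2) + 2 : ℝ) = 3 by norm_num, zero_mul, zero_add, Real.rpow_one,
        Real.rpow_one]
      gcongr
    · rw [Real.rpow_zero, mul_one]
      have h0 : 0 ≤ s - 1 / 2 * R := by linarith
      refine le_trans ?_ (hlow s hs (by linarith))
      gcongr
      linarith
  · have hm : 2 ≤ b ^ 2 - 6 := by nlinarith
    have h := hstep R T w₀ w₁ z w wt hR hw A b (b ^ 2 - 6) k hA (by linarith) hm hk
      (fun s hs hsb => ?_) t ht htb
    · have hpos := logFactor_nonneg hR (by linarith) htb
      have hs := (stepLoss_pos (α := growthExp n p) (p := p) (by linarith : 1 / 2 ≤ b) hm hk).le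
      have h0 : 0 ≤ t - (2 * b + 2) * R := by linarith
      have hle := logFactor_next_le hR hb htb
      have hk' : 0 ≤ k * p + 1 := by positivity
      refine le_trans ?_ h
      gcongr
    · have := hlow s hs hsb
      rwa [logFactor, show (b - 2) * (b + 3) = b + (b ^ 2 - 6) by ring] at this

/-! ### Accumulated losses -/

/-- `X j ≥ exp (-h j)` for some `h` and all `j ≥ 1`. -/
def DecaysAtMostExp (X : ℕ → ℝ) : Prop := ∃ h : ℝ, ∀ j : ℕ, 1 ≤ j → Real.exp (-(h * j)) ≤ X j

theorem DecaysAtMostExp.const {c : ℝ} (hc : 0 < c) : DecaysAtMostExp fun _ => c := by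
  refine ⟨|Real.log c|, fun j hj => ?_⟩
  rw [← Real.le_log_iff_exp_le hc]
  have hj : (1 : ℝ) ≤ j := by exact_mod_cast hj
  nlinarith [abs_nonneg (Real.log c), neg_abs_le (Real.log c)]

theorem DecaysAtMostExp.mul {X Y : ℕ → ℝ} (hX : DecaysAtMostExp X) (hY : DecaysAtMostExp Y) :
    DecaysAtMostExp fun j => X j * Y j := by
  obtain ⟨h₁, hX⟩ := hX
  obtain ⟨h₂, hY⟩ := hY
  refine ⟨h₁ + h₂, fun j hj => ?_⟩
  rw [show -((h₁ + h₂) * (j : ℝ)) = -(h₁ * j) + -(h₂ * j) by ring, Real.exp_add]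
  exact mul_le_mul (hX j hj) (hY j hj) (Real.exp_pos _).le ((Real.exp_pos _).le.trans (hX j hj))

theorem DecaysAtMostExp.rpow {X : ℕ → ℝ} (hX : DecaysAtMostExp X) {r : ℝ} (hr : 0 ≤ r) :
    DecaysAtMostExp fun j => X j ^ r := by
  obtain ⟨h, hX⟩ := hX
  refine ⟨h * r, fun j hj => ?_⟩
  rw [show -(h * r * (j : ℝ)) = -(h * j) * r by ring, Real.exp_mul]
  exact Real.rpow_le_rpow (Real.exp_pos _).le (hX j hj) hr

theorem DecaysAtMostExp.rpow_neg {Y : ℕ → ℝ} {B s : ℝ} (hB : 0 < B) (hs : 0 ≤ s)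
    (hY0 : ∀ j, 1 ≤ j → 0 < Y j) (hY : ∀ j, 1 ≤ j → Y j ≤ B ^ j) :
    DecaysAtMostExp fun j => Y j ^ (-s) := by
  refine ⟨s * Real.log B, fun j hj => ?_⟩
  have e : Real.exp (-(s * Real.log B * (j : ℝ))) = (B ^ j) ^ (-s) := by
    rw [Real.rpow_def_of_pos (by positivity), Real.log_pow]; congr 1; ring
  rw [e]
  exact Real.rpow_le_rpow_of_nonpos (hY0 j hj) (hY j hj) (by linarith)

theorem mul_pow_le_mul_pow {C B x : ℝ} (hC : 1 ≤ C) (hB : 0 ≤ B) {j : ℕ} (hj : 1 ≤ j)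
    (hx : x ≤ C * B ^ j) : x ≤ (C * B) ^ j := by
  refine hx.trans ?_
  rw [mul_pow]
  gcongr
  exact le_self_pow₀ hC (by omega)

/-- The exponent `(p^(2j) - 1) / (p - 1)` of the logarithm after `j` rounds. -/
noncomputable def logExp (p : ℝ) (j : ℕ) : ℝ := (p ^ (2 * j) - 1) / (p - 1)

theorem logExp_nonneg {p : ℝ} (hp : 1 < p) (j : ℕ) : 0 ≤ logExp p j :=
  div_nonneg (sub_nonneg.2 (one_le_pow₀ hp.le)) (by linarith)

theorem logExp_succ {p : ℝ} (hp : 1 < p) (j : ℕ) :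
    logExp p (j + 1) = (logExp p j * p + 1) * p + 1 := by
  have : p - 1 ≠ 0 := by linarith
  unfold logExp
  field_simp
  ring

theorem b_succ {j : ℕ} (hj : 1 ≤ j) : b (j + 1) = 2 * (2 * b j + 2) + 2 := by
  obtain ⟨i, rfl⟩ : ∃ i, j = i + 1 := ⟨j - 1, by omega⟩
  simp only [b, Nat.add_sub_cancel]
  ring

theorem eight_le_b (j : ℕ) : 8 ≤ b j := by
  have : (1 : ℝ) ≤ 4 ^ (j - 1) := one_le_pow₀ (by norm_num)
  unfold b
  linarith

theorem b_le {j : ℕ} (hj : 1 ≤ j) : b j + 2 ≤ 10 ^ j := by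
  obtain ⟨i, rfl⟩ : ∃ i, j = i + 1 := ⟨j - 1, by omega⟩
  have : (4 : ℝ) ^ i ≤ 10 ^ i := by gcongr; norm_num
  simp only [b, Nat.add_sub_cancel]
  rw [pow_succ]
  linarith

/-- The factor lost in the `j`-th round, which consists of two steps. -/
noncomputable def roundLoss (α p c : ℝ) (j : ℕ) : ℝ :=
  c * stepLoss α p (2 * b j + 2) ((2 * b j + 2) ^ 2 - 6) (logExp p j * p + 1)
    * (c * stepLoss α p (b j) (b j ^ 2 - 6) (logExp p j)) ^ p

theorem decaysAtMostExp_roundLoss {α p c : ℝ} (hα : 0 ≤ α) (hp : 1 < p) (hp2 : p ≤ 2)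
    (hc : 0 < c) : DecaysAtMostExp (roundLoss α p c) := by
  have hp0 : 0 ≤ p := by linarith
  have hp1 : 0 < p - 1 := by linarith
  have hB : 0 < p ^ 2 / (p - 1) := by positivity
  have hk (j : ℕ) (hj : 1 ≤ j) : logExp p j + 1 ≤ (p ^ 2 / (p - 1)) ^ j := by
    have h1 : (p - 1) ^ j ≤ p - 1 := pow_le_of_le_one hp1.le (by linarith) (by omega)
    calc logExp p j + 1 ≤ (p ^ 2) ^ j / (p - 1) := by
          rw [logExp, ← pow_mul, div_add_one hp1.ne']
          gcongr
          linarith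
      _ ≤ (p ^ 2) ^ j / (p - 1) ^ j := by gcongr
      _ = _ := by rw [div_pow]
  have hpow (x : ℝ) (j : ℕ) : (x ^ j) ^ 3 = (x ^ 3) ^ j := by rw [← pow_mul, ← pow_mul, mul_comm]
  unfold roundLoss
  refine ((DecaysAtMostExp.const hc).mul ?_).mul (((DecaysAtMostExp.const hc).mul ?_).rpow hp0)
  · refine ((DecaysAtMostExp.rpow_neg (B := 2 * (p ^ 2 / (p - 1))) (by positivity) hp0
      (fun j _ => ?_) fun j hj => ?_).mul (DecaysAtMostExp.rpow_neg (B := 5 * 10) (by norm_num)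
      (by positivity) (fun j _ => ?_) fun j hj => ?_)).mul
      (DecaysAtMostExp.rpow_neg (B := 48 * 10 ^ 3) (by norm_num) hp1.le
      (fun j _ => ?_) fun j hj => ?_)
    · have := logExp_nonneg hp j; positivity
    · refine mul_pow_le_mul_pow (by norm_num) hB.le hj ?_
      have := hk j hj
      have := logExp_nonneg hp j
      nlinarith
    · linarith [eight_le_b j]
    · exact mul_pow_le_mul_pow (by norm_num) (by norm_num) hj
        (by linarith [b_le hj, eight_le_b j])
    · have := eight_le_b j
      exact mul_pos (by linarith) (by nlinarith)
    · refine mul_pow_le_mul_pow (by norm_num) (by norm_num) hj ?_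
      rw [← hpow]
      have h8 := eight_le_b j
      calc (2 * (2 * b j + 2) + 3) * (2 * (2 * b j + 2) + 1 + 2 * ((2 * b j + 2) ^ 2 - 6))
          ≤ (4 * (b j + 2)) * (12 * (b j + 2) ^ 2) := by
            refine mul_le_mul (by linarith) (by nlinarith) (by nlinarith) (by linarith)
        _ = 48 * (b j + 2) ^ 3 := by ring
        _ ≤ 48 * (10 ^ j) ^ 3 := by
            have := b_le hj
            have : 0 ≤ b j + 2 := by linarith
            gcongr
  · refine ((DecaysAtMostExp.rpow_neg hB hp0
      (fun j _ => ?_) hk).mul (DecaysAtMostExp.rpow_neg (B := 3 * 10) (by norm_num)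
      (by positivity) (fun j _ => ?_) fun j hj => ?_)).mul
      (DecaysAtMostExp.rpow_neg (B := 8 * 10 ^ 3) (by norm_num) hp1.le
      (fun j _ => ?_) fun j hj => ?_)
    · have := logExp_nonneg hp j; positivity
    · linarith [eight_le_b j]
    · refine mul_pow_le_mul_pow (by norm_num) (by norm_num) hj ?_
      linarith [b_le hj, eight_le_b j]
    · have := eight_le_b j
      exact mul_pos (by linarith) (by nlinarith)
    · refine mul_pow_le_mul_pow (by norm_num) (by norm_num) hj ?_
      rw [← hpow]
      have h8 := eight_le_b j
      calc (2 * b j + 3) * (2 * b j + 1 + 2 * (b j ^ 2 - 6))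
          ≤ (2 * (b j + 2)) * (4 * (b j + 2) ^ 2) := by
            refine mul_le_mul (by linarith) (by nlinarith) (by nlinarith) (by linarith)
        _ = 8 * (b j + 2) ^ 3 := by ring
        _ ≤ 8 * (10 ^ j) ^ 3 := by
            have := b_le hj
            have : 0 ≤ b j + 2 := by linarith
            gcongr

/-- The accumulated losses `-h ∑_{i < j} i p^(-2i)` of the rounds before the `j`-th bound. -/
noncomputable def lossSum (p h : ℝ) (j : ℕ) : ℝ :=
  -(h * ∑ i ∈ Finset.range j, (i : ℝ) * ((p ^ 2)⁻¹) ^ i)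

theorem exists_tendsto_lossSum {p : ℝ} (hp : 1 < p) (h : ℝ) :
    ∃ l : ℝ, Tendsto (lossSum p h) atTop (𝓝 l) := by
  have hr : ‖(p ^ 2)⁻¹‖ < 1 := by
    rw [Real.norm_of_nonneg (by positivity)]
    exact inv_lt_one_of_one_lt₀ (by nlinarith)
  have hs := summable_pow_mul_geometric_of_norm_lt_one 1 hr
  simp only [pow_one] at hs
  exact ⟨_, ((hs.hasSum.tendsto_sum_nat).const_mul h).neg⟩

/-- As `lossSum` vanishes at `1`, the formula for `D_j`, `j ≥ 2`, also holds for `j = 1`. -/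
theorem D_lossSum_eq {p C ε h : ℝ} (hC : 0 < C) (hε : 0 < ε) {j : ℕ} (hj : 1 ≤ j) :
    D p C ε (lossSum p h) j
      = Real.exp (p ^ (2 * (j - 1)) * (Real.log (C * ε ^ (p ^ 3)) + lossSum p h j)) := by
  unfold D
  split_ifs with h1
  · subst h1
    have : 0 < C * ε ^ (p ^ 3) := by positivity
    simp [lossSum, Real.exp_log this]
  · rfl

theorem D_lossSum_succ {p C ε h : ℝ} (hp : 1 < p) (hC : 0 < C) (hε : 0 < ε) {j : ℕ} (hj : 1 ≤ j) :
    D p C ε (lossSum p h) (j + 1)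
      = Real.exp (-(h * j)) * D p C ε (lossSum p h) j ^ (p * p) := by
  rw [D_lossSum_eq hC hε hj, D_lossSum_eq hC hε (by omega), ← Real.exp_mul, ← Real.exp_add]
  obtain ⟨i, rfl⟩ : ∃ i, j = i + 1 := ⟨j - 1, by omega⟩
  congr 1
  have hp0 : p ≠ 0 := by linarith
  simp only [lossSum, Nat.add_sub_cancel]
  rw [Finset.sum_range_succ _ (i + 1)]
  have e : p ^ (2 * (i + 1)) * ((p ^ 2)⁻¹) ^ (i + 1) = 1 := by
    rw [pow_mul, ← mul_pow, mul_inv_cancel₀ (by positivity), one_pow]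
  have e2 : p ^ (2 * (i + 1)) = p ^ (2 * i) * (p * p) := by ring
  push_cast at e ⊢
  linear_combination (-(h * ((i : ℝ) + 1))) * e
    + (Real.log (C * ε ^ p ^ 3) - h * ∑ x ∈ Finset.range (i + 1), (x : ℝ) * ((p ^ 2)⁻¹) ^ x) * e2

/-! ### Solutions of the system -/

section Solution

variable {p R ε : ℝ} {T : EReal} {f₁ g₁ f₂ g₂ : L2 n} {u ut v vt : ℝ → L2 n}

theorem L2_smul_nonneg (hε : 0 ≤ ε) {f : L2 n} (hf : 0 ≤ f) : 0 ≤ ε • f := by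
  rw [← Lp.coeFn_nonneg]
  filter_upwards [Lp.coeFn_smul ε f, L2_ae_nonneg hf] with x hx hfx
  rw [hx]
  exact mul_nonneg hε hfx

theorem IsWeakWave.continuousOn {r : ℝ} {w₀ w₁ : L2 n} {z w wt : ℝ → L2 n}
    (hw : IsWeakWave r R T w₀ w₁ z w wt) : ContinuousOn w (timeInterval T) :=
  fun t ht => (hw.time_deriv t ht).continuousWithinAt

theorem IsSolution.isDrivenWave (hs : IsSolution p p R ε T f₁ g₁ f₂ g₂ u ut v vt) (hε : 0 ≤ ε)
    (hf₁ : 0 ≤ f₁) (hg₁ : 0 ≤ g₁) (hf₂ : 0 ≤ f₂) (hg₂ : 0 ≤ g₂) :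
    IsDrivenWave p R T (ε • f₁) (ε • g₁) v u ut ∧ IsDrivenWave p R T (ε • f₂) (ε • g₂) u v vt :=
  ⟨⟨hs.first, L2_smul_nonneg hε hf₁, L2_smul_nonneg hε hg₁, hs.second.continuousOn,
      hs.second.support⟩,
    ⟨hs.second, L2_smul_nonneg hε hf₂, L2_smul_nonneg hε hg₂, hs.first.continuousOn,
      hs.first.support⟩⟩

theorem IsInitialVelocity.integral_pos {g : L2 n} (hg : IsInitialVelocity R g) : 0 < ∫ x, g x := by
  have h0 := L2_ae_nonneg hg.nonneg
  refine lt_of_le_of_ne (integral_nonneg_of_ae h0) fun h => hg.ne_zero ?_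
  exact (Lp.eq_zero_iff_ae_eq_zero).2
    ((integral_eq_zero_iff_of_nonneg_ae h0 hg.support.integrable).1 h.symm)

theorem integral_smul_coe (ε : ℝ) (g : L2 n) : ∫ x, (ε • g : L2 n) x = ε * ∫ x, g x := by
  rw [← integral_const_mul]
  refine integral_congr_ae ?_
  filter_upwards [Lp.coeFn_smul ε g] with x hx
  rw [hx]; rfl

end Solution

end WaveSystem

theorem proposition3p2 (n : ℕ) (hn : 4 ≤ n) (p : ℝ) (hp : 1 < p)
    (hF : WaveSystem.criticalF p p n = 0) :
    ∃ S : ℕ → ℝ, (∃ l : ℝ, Tendsto S atTop (𝓝 l)) ∧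
      ∀ R : ℝ, 0 < R → ∀ f₂ g₂ : WaveSystem.L2 n,
        WaveSystem.IsInitialPosition R f₂ → WaveSystem.IsInitialVelocity R g₂ →
        ∃ C : ℝ, 0 < C ∧
          ∀ f₁ g₁ : WaveSystem.L2 n,
            WaveSystem.IsInitialPosition R f₁ → MemLp f₁ (ENNReal.ofReal p) volume →
            WaveSystem.IsInitialVelocity R g₁ →
            ∀ (ε : ℝ), 0 < ε → ∀ (T : EReal), 0 < T → ∀ u ut v vt : ℝ → WaveSystem.L2 n,
              WaveSystem.IsSolution p p R ε T f₁ g₁ f₂ g₂ u ut v vt →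
              ContDiffOn ℝ 2 (WaveSystem.spatialIntegral u) (WaveSystem.timeInterval T) ∧
              ∀ j : ℕ, 1 ≤ j → ∀ t : ℝ, t ∈ WaveSystem.timeInterval T →
                WaveSystem.b j * R ≤ t →
                WaveSystem.D p C ε S j
                    * (t - WaveSystem.b j * R) ^ ((n : ℝ) - 1 - ((n : ℝ) - 1) * p / 2)
                    * (Real.log ((t + (WaveSystem.b j ^ 2 - 6) * R)
                        / ((WaveSystem.b j - 2) * (WaveSystem.b j + 3) * R)))
                      ^ ((p ^ (2 * j) - 1) / (p - 1))
                  ≤ deriv (deriv (WaveSystem.spatialIntegral u)) t := by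
  open WaveSystem in
  have hp2 := le_two_of_criticalF hn hp hF
  have hp0 : 0 < p := by linarith
  have hα := growthExp_nonneg (n := n) (by omega) hp2
  obtain ⟨c, hc, hstep⟩ := exists_growthBound_step hn hp hF
  obtain ⟨c₀, e, hc₀, hinit⟩ := exists_initial_bound hn hp hp2
  obtain ⟨h, hloss⟩ := decaysAtMostExp_roundLoss hα hp hp2 hc
  refine ⟨lossSum p h, exists_tendsto_lossSum hp h, fun R hR f₂ g₂ hf₂ hg₂ => ?_⟩
  set C₀ : ℝ := c₀ * R ^ (p - 1) * ((2 * R) ^ e * ∫ x, g₂ x) ^ p with hC₀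
  have hg₂pos := hg₂.integral_pos
  have hC₀pos : 0 < C₀ := by positivity
  set L₀ : ℝ := stepLoss (growthExp n p) p (1 / 2) 2 0 with hL₀
  set L₁ : ℝ := stepLoss (growthExp n p) p 3 (3 ^ 2 - 6) 1 with hL₁
  have hL₀pos : 0 < L₀ := stepLoss_pos le_rfl le_rfl le_rfl
  have hL₁pos : 0 < L₁ := stepLoss_pos (by norm_num) (by norm_num) (by norm_num)
  refine ⟨c * L₁ * (c * L₀ * C₀ ^ p) ^ p, by positivity, ?_⟩
  set C : ℝ := c * L₁ * (c * L₀ * C₀ ^ p) ^ p with hC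
  have hCpos : 0 < C := by positivity
  intro f₁ g₁ hf₁ _ hg₁ ε hε T hT u ut v vt hsol
  obtain ⟨hu, hv⟩ := hsol.isDrivenWave hε.le hf₁.nonneg hg₁.nonneg hf₂.nonneg hg₂.nonneg
  refine ⟨hsol.first.contDiffOn_spatialIntegral hp hp2 hT hu.continuous_source hu.support_source,
    ?_⟩
  have hv0 (t : ℝ) (ht : t ∈ timeInterval T) (htR : R / 2 ≤ t) :
      C₀ * ε ^ p * (t + 2 * R) ^ growthExp n p ≤ powIntegral p (v t) := by
    have h1 := hinit R T _ _ u v vt hR hv t ht htR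
    rw [integral_smul_coe] at h1
    refine le_trans (le_of_eq ?_) h1
    rw [mul_left_comm, Real.mul_rpow hε.le (by positivity), hC₀]
    ring
  have hmain (j : ℕ) (hj : 1 ≤ j) :
      GrowthBound p R T (D p C ε (lossSum p h) j) (b j) (logExp p j) v := by
    induction j, hj using Nat.le_induction with
    | base =>
      -- the bound from the initial velocity holds for `t ≥ R / 2`; one step leads to `b = 3`, and
      -- the next one to `b = 8`
      have hu1 := (hstep R T _ _ v u ut hR hu _ (by positivity)).1 hv0
      have hv1 := (hstep R T _ _ u v vt hR hv _ (by positivity)).2 3 1 le_rfl zero_le_one hu1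
      have eD : D p C ε (lossSum p h) 1 = c * L₁ * (c * L₀ * (C₀ * ε ^ p) ^ p) ^ p := by
        rw [D, if_pos rfl, hC, Real.mul_rpow hC₀pos.le (by positivity), ← mul_assoc (c * L₀),
          Real.mul_rpow (x := c * L₀ * C₀ ^ p) (by positivity) (by positivity),
          ← Real.rpow_mul hε.le, ← Real.rpow_mul hε.le, show p ^ 3 = p * p * p by ring]
        ring
      have eb : b 1 = 2 * 3 + 2 := by norm_num [b]
      have ek : logExp p 1 = 1 * p + 1 := by
        have : p - 1 ≠ 0 := by linarith
        rw [logExp]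
        field_simp
        ring
      rw [eD, eb, ek]
      exact hv1
    | succ j hj ih =>
      have hDpos : 0 < D p C ε (lossSum p h) j := by
        rw [D_lossSum_eq hCpos hε hj]; exact Real.exp_pos _
      have hb := eight_le_b j
      have hk := logExp_nonneg hp j
      have hs1 : 0 < stepLoss (growthExp n p) p (b j) (b j ^ 2 - 6) (logExp p j) :=
        stepLoss_pos (by linarith) (by nlinarith) hk
      have hu1 := (hstep R T _ _ v u ut hR hu _ hDpos.le).2 _ _ (by linarith) hk ih
      have hv1 := (hstep R T _ _ u v vt hR hv _ (by positivity)).2 _ _ (by linarith)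
        (by positivity) hu1
      rw [b_succ hj, logExp_succ hp, D_lossSum_succ hp hCpos hε hj]
      refine hv1.mono hR (by linarith) ?_
      rw [Real.mul_rpow (x := c * stepLoss (growthExp n p) p (b j) (b j ^ 2 - 6) (logExp p j))
        (by positivity) (by positivity), ← Real.rpow_mul hDpos.le, ← mul_assoc]
      exact mul_le_mul_of_nonneg_right (hloss j hj) (by positivity)
  intro j hj t ht htb
  have ht0 : 0 < t := by
    have := eight_le_b j
    nlinarith
  rw [hsol.first.deriv_deriv_spatialIntegral hp0.ne' hu.support_source ht0 ht]
  exact hmain j hj t ht htb
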